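/- Let $T$ be a locally compact Polish space with its Borel $\sigma$-algebra, $\sigma$ a non-atomic Radon measure on $T$, and $A\subset T^2$ a symmetric Borel set which contains the diagonal and satisfies $\sigma^{\otimes2}(A)=0$. Let $Q:T^2\setminus A\to\{z\in\mathbb C: |z|=1\}$ be measurable with $Q(s,t)=\overline{Q(t,s)}$, and let $\lambda\in\mathbb R$. Let $P_n$ be the $Q$-symmetrization operator on $L^2(T^n\to\mathbb C,\sigma^{\otimes n})$, $$(P_nf)(t_1,\dots,t_n)=\frac1{n!}\sum_{\pi\in S_n}\Big(\prod_{i<j,\ \pi(i)>\pi(j)}Q(t_i,t_j)\Big)f(t_{\pi^{-1}(1)},\dots,t_{\pi^{-1}(n)}),$$ let $\mathcal H^{\circledast n}$ be its range, let $\mathcal F^Q=\bigoplus_{n\ge0}n!\,\mathcal H^{\circledast n}$ (the inner product of $\mathcal H^{\circledast n}$ is multiplied by $n!$, and $\mathcal H^{\circledast 0}=\mathbb C$) be the $Q$-Fock space, $\mathcal F^Q_{\rm fin}$ its subspace of finite sequences, and $\Omega=(1,0,0,\dots)$ the vacuum. For a real-valued bounded Borel function $f$ on $T$ with compact support, consider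 the following operators on $\mathcal F^Q_{\rm fin}$: the creation operator $a^+(f)g^{(n)}=P_{n+1}(f\otimes g^{(n)})$, its adjoint $a^-(f)$ (restricted to $\mathcal F^Q_{\rm fin}$), the neutral operator $(a^0(f)g^{(n)})(t_1,\dots,t_n)=(f(t_1)+\dots+f(t_n))\,g^{(n)}(t_1,\dots,t_n)$, and $$\langle f,\omega\rangle=a^+(f)+\lambda a^0(f)+a^-(f).$$ Let $\mathscr P$ be the complex unital $*$-algebra generated by all the operators $\langle f,\omega\rangle$, and let $\tau(p)=(p\,\Omega,\Omega)_{\mathcal F^Q}$, $p\in\mathscr P$, be the vacuum state. Then $\tau$ is tracial, i.e. $\tau(p_1p_2)=\tau(p_2p_1)$ for all $p_1,p_2\in\mathscr P$, if and only if one of the following holds: - $Q=1$ $\sigma^{\otimes2}$-almost everywhere and $\lambda\ne0$; or - $Q$ takes values in $\{-1,1\}$ $\sigma^{\otimes2}$-almost everywhere and $\lambda=0$. -/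

import Mathlib

open MeasureTheory Filter
open scoped ENNReal ComplexConjugate Nat DirectSum

noncomputable section

namespace QFock

/-- A statistics function on `(T, σ)`: a measurable function
`Q : T ^ 2 \ A → {z ∈ ℂ | |z| = 1}` which is Hermitian, `Q (s, t) = conj (Q (t, s))`, where `A` is
a symmetric measurable null set which contains the diagonal. -/
structure StatisticsKernel {T : Type*} [MeasurableSpace T] (σ : Measure T) where
  /-- the exceptional set -/
  A : Set (T × T)
  measurableSet_A : MeasurableSet A
  symm_A : ∀ p ∈ A, p.swap ∈ A
  diag_subset_A : ∀ t, (t, t) ∈ A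
  null_A : σ.prod σ A = 0
  /-- the statistics function, defined outside of `A` -/
  Q : {p : T × T // p ∉ A} → ℂ
  measurable_Q : Measurable Q
  norm_Q : ∀ p, ‖Q p‖ = 1
  hermitian_Q : ∀ (s t : T) (h : (s, t) ∉ A) (h' : (t, s) ∉ A),
    Q ⟨(s, t), h⟩ = conj (Q ⟨(t, s), h'⟩)

section Kernel

variable {T : Type*} [MeasurableSpace T] {σ : Measure T} (K : StatisticsKernel σ)

open scoped Classical in
/-- The extension of `Q` to all of `T ^ 2` by the value `1` on the null set `A`. -/
def StatisticsKernel.qfun (s t : T) : ℂ :=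
  if h : (s, t) ∉ K.A then K.Q ⟨(s, t), h⟩ else 1

theorem StatisticsKernel.measurable_qfun : Measurable fun p : T × T => K.qfun p.1 p.2 := by
  classical
  have h := Measurable.dite (s := {p : T × T | p ∉ K.A}) K.measurable_Q
    (g := fun _ => (1 : ℂ)) measurable_const K.measurableSet_A.compl
  exact h

theorem StatisticsKernel.norm_qfun (s t : T) : ‖K.qfun s t‖ = 1 := by
  unfold StatisticsKernel.qfun
  by_cases h : (s, t) ∈ K.A
  · simp [h]
  · simpa [h] using K.norm_Q _

theorem StatisticsKernel.qfun_conj (s t : T) : K.qfun s t = conj (K.qfun t s) := by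
  unfold StatisticsKernel.qfun
  by_cases h : (s, t) ∈ K.A
  · have h' : (t, s) ∈ K.A := K.symm_A _ h
    simp [h, h']
  · have h' : (t, s) ∉ K.A := fun h' => h (K.symm_A _ h')
    simp only [h, h', not_false_eq_true, dite_true]
    exact K.hermitian_Q s t h h'

theorem StatisticsKernel.qfun_mul_swap (s t : T) : K.qfun s t * K.qfun t s = 1 := by
  rw [K.qfun_conj s t, mul_comm, Complex.mul_conj, Complex.normSq_eq_norm_sq, K.norm_qfun]
  simp

theorem StatisticsKernel.qfun_self (t : T) : K.qfun t t = 1 := by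
  simp [StatisticsKernel.qfun, K.diag_subset_A t]

/-- `Q_π (t₁, …, tₙ) = ∏ Q (tᵢ, tⱼ)`, the product being over all `i < j` with `π i > π j`. -/
def phase {n : ℕ} (π : Equiv.Perm (Fin n)) (t : Fin n → T) : ℂ :=
  ∏ p : Fin n × Fin n with p.1 < p.2 ∧ π p.2 < π p.1, K.qfun (t p.1) (t p.2)

theorem measurable_phase {n : ℕ} (π : Equiv.Perm (Fin n)) : Measurable (phase K π) := by
  unfold phase
  refine Finset.measurable_prod _ fun p _ => ?_
  exact K.measurable_qfun.comp (g := fun p : T × T => K.qfun p.1 p.2)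
    (f := fun t : Fin n → T => (t p.1, t p.2))
    ((measurable_pi_apply p.1).prodMk (measurable_pi_apply p.2))

theorem norm_phase {n : ℕ} (π : Equiv.Perm (Fin n)) (t : Fin n → T) : ‖phase K π t‖ = 1 := by
  simp [phase, norm_prod, K.norm_qfun]

theorem phase_one {n : ℕ} (t : Fin n → T) : phase K 1 t = 1 := by
  unfold phase
  rw [Finset.filter_false_of_mem, Finset.prod_empty]
  rintro p - ⟨h1, h2⟩
  exact absurd h1 (not_lt_of_gt h2)

theorem prod_prod_eq_of_symm {n : ℕ} (G H : Fin n → Fin n → ℂ)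
    (hd : ∀ i, G i i = H i i) (hs : ∀ i j, i < j → G i j * G j i = H i j * H j i) :
    ∏ i, ∏ j, G i j = ∏ i, ∏ j, H i j := by
  have key : ∀ F : Fin n → Fin n → ℂ, ∏ i, ∏ j, F i j =
      ∏ i, ∏ j, ((if i < j then F i j * F j i else 1) * (if i = j then F i i else 1)) := by
    intro F
    have e : ∀ i j, F i j = (if i < j then F i j else 1) *
        ((if j < i then F i j else 1) * (if i = j then F i i else 1)) := by
      intro i j
      rcases lt_trichotomy i j with h | h | h
      · simp [h, h.not_gt, h.ne]
      · subst h; simp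
      · simp [h, h.not_gt, h.ne']
    calc ∏ i, ∏ j, F i j
        = (∏ i, ∏ j, if i < j then F i j else 1) *
          ((∏ i, ∏ j, if j < i then F i j else 1) * ∏ i, ∏ j, if i = j then F i i else 1) := by
            simp_rw [← Finset.prod_mul_distrib]
            exact Finset.prod_congr rfl fun i _ => Finset.prod_congr rfl fun j _ => e i j
      _ = _ := by
            rw [Finset.prod_comm (f := fun i j => if j < i then F i j else 1), ← mul_assoc]
            simp_rw [← Finset.prod_mul_distrib]
            refine Finset.prod_congr rfl fun i _ => Finset.prod_congr rfl fun j _ => ?_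
            split_ifs <;> simp
  rw [key G, key H]
  refine Finset.prod_congr rfl fun i _ => Finset.prod_congr rfl fun j _ => ?_
  rw [hd i]
  split_ifs with h
  · rw [hs i j h]
  · rw [hs i j h]
  · rfl
  · rfl

theorem phase_eq_prod {n : ℕ} (π : Equiv.Perm (Fin n)) (t : Fin n → T) :
    phase K π t = ∏ i, ∏ j, if i < j ∧ π j < π i then K.qfun (t i) (t j) else 1 := by
  rw [phase, Finset.prod_filter, Fintype.prod_prod_type]

theorem phase_mul {n : ℕ} (α β : Equiv.Perm (Fin n)) (t : Fin n → T) :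
    phase K (β * α) t = phase K α t * phase K β (t ∘ ⇑α⁻¹) := by
  have h2 : phase K β (t ∘ ⇑α⁻¹) =
      ∏ i, ∏ j, if α i < α j ∧ β (α j) < β (α i) then K.qfun (t i) (t j) else 1 := by
    rw [phase_eq_prod, ← Equiv.prod_comp α]
    refine Finset.prod_congr rfl fun i _ => ?_
    rw [← Equiv.prod_comp α]
    simp
  rw [h2, phase_eq_prod, phase_eq_prod]
  simp_rw [← Finset.prod_mul_distrib]
  apply prod_prod_eq_of_symm
  · simp
  · intro i j hij
    have hne : α i ≠ α j := fun h => hij.ne (α.injective h)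
    have hne2 : β (α i) ≠ β (α j) := fun h => hne (β.injective h)
    have hm := K.qfun_mul_swap (t i) (t j)
    rcases lt_or_gt_of_ne hne with h | h <;> rcases lt_or_gt_of_ne hne2 with h3 | h3 <;>
      simp [hij, hij.not_gt, h, h.not_gt, h3, h3.not_gt, hm]

/-- For the transposition of neighbours `j, j + 1` the only inversion is `(j, j + 1)`. -/
theorem phase_swap {n : ℕ} (j : Fin n) (t : Fin (n + 1) → T) :
    phase K (Equiv.swap j.castSucc j.succ) t = K.qfun (t j.castSucc) (t j.succ) := by
  have : (Finset.univ.filter fun p : Fin (n + 1) × Fin (n + 1) => p.1 < p.2 ∧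
      Equiv.swap j.castSucc j.succ p.2 < Equiv.swap j.castSucc j.succ p.1) =
      {(j.castSucc, j.succ)} := by
    ext ⟨a, b⟩
    rw [Finset.mem_filter, Finset.mem_singleton, Prod.mk.injEq]
    simp only [Finset.mem_univ, true_and, Equiv.swap_apply_def]
    simp only [Fin.ext_iff, Fin.lt_def, apply_ite Fin.val, Fin.val_castSucc, Fin.val_succ]
    split_ifs <;> omega
  rw [phase, this, Finset.prod_singleton]

end Kernel

section Operators

variable {T : Type*} [MeasurableSpace T] (σ : Measure T)

/-- The complex `n`-particle space `L²(T ^ n → ℂ, σ ^ ⊗ n)`, the `n`-th tensor power of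
`L²(T → ℂ, σ)`. -/
abbrev NSpace (n : ℕ) : Type _ := Lp ℂ 2 (Measure.pi fun _ : Fin n => σ)

/-- The operator of multiplication by an essentially bounded function in `L²(μ)`. -/
def mulOp {X : Type*} [MeasurableSpace X] {μ : Measure X} (g : X → ℂ) (hg : MemLp g ∞ μ) :
    Lp ℂ 2 μ →L[ℂ] Lp ℂ 2 μ :=
  (ContinuousLinearMap.mul ℂ ℂ).holderL μ ∞ 2 2 (hg.toLp g)

theorem coeFn_mulOp {X : Type*} [MeasurableSpace X] {μ : Measure X} (g : X → ℂ)
    (hg : MemLp g ∞ μ) (f : Lp ℂ 2 μ) : mulOp g hg f =ᵐ[μ] fun x => g x * f x := by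
  filter_upwards [(ContinuousLinearMap.mul ℂ ℂ).coeFn_holder (r := 2) (hg.toLp g) f,
    hg.coeFn_toLp] with x hx hx2
  have : mulOp g hg f x = g x * f x := by
    rw [← hx2]; exact hx
  exact this

variable {σ} (K : StatisticsKernel σ)

theorem memLp_phase {n : ℕ} (π : Equiv.Perm (Fin n)) :
    MemLp (phase K π) ∞ (Measure.pi fun _ : Fin n => σ) :=
  memLp_top_of_bound (measurable_phase K π).aestronglyMeasurable 1
    (Eventually.of_forall fun t => (norm_phase K π t).le)

theorem memLp_sum {h : T → ℂ} (hh : Measurable h) {C : ℝ} (hC : ∀ t, ‖h t‖ ≤ C) (n : ℕ) :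
    MemLp (fun t : Fin n → T => ∑ i, h (t i)) ∞ (Measure.pi fun _ : Fin n => σ) := by
  refine memLp_top_of_bound (C := n * C) ?_ (Eventually.of_forall fun t => ?_)
  · exact (Finset.measurable_sum _ fun i _ =>
      hh.comp (measurable_pi_apply i)).aestronglyMeasurable
  · calc ‖∑ i, h (t i)‖ ≤ ∑ i : Fin n, C := norm_sum_le_of_le _ fun i _ => hC (t i)
      _ = n * C := by simp

theorem aesm_tensor {n : ℕ} (h : Lp ℂ 2 σ) (f : NSpace σ n) :
    AEStronglyMeasurable (fun p : T × (Fin n → T) => h p.1 * f p.2)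
      (σ.prod (Measure.pi fun _ : Fin n => σ)) :=
  ((Lp.aestronglyMeasurable h).comp_quasiMeasurePreserving
    Measure.quasiMeasurePreserving_fst).mul
  ((Lp.aestronglyMeasurable f).comp_quasiMeasurePreserving
    Measure.quasiMeasurePreserving_snd)

variable [SigmaFinite σ]

theorem measurePreserving_perm {n : ℕ} (π : Equiv.Perm (Fin n)) :
    MeasurePreserving (fun t : Fin n → T => t ∘ π)
      (Measure.pi fun _ : Fin n => σ) (Measure.pi fun _ : Fin n => σ) := by
  have h := measurePreserving_piCongrLeft (α := fun _ : Fin n => T) (fun _ => σ) π⁻¹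
  convert h using 1
  funext t
  funext i
  have := Equiv.piCongrLeft_apply_apply (fun _ : Fin n => T) π⁻¹ t (π i)
  rw [show π⁻¹ (π i) = i from π.symm_apply_apply i] at this
  exact this.symm

/-- The action `π ↦ Ψ_π` of the symmetric group on the `n`-particle space:
`(Ψ_π f) (t₁, …, tₙ) = Q_{π⁻¹} (t₁, …, tₙ) f (t_{π 1}, …, t_{π n})`. By `Psi_swap` and `Psi_mul`
below it is the multiplicative extension of the operators
`(Ψ_j f) (t₁, …, tₙ) = Q (t_j, t_{j+1}) f (t₁, …, t_{j+1}, t_j, …, tₙ)`. -/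
def Psi {n : ℕ} (π : Equiv.Perm (Fin n)) : NSpace σ n →L[ℂ] NSpace σ n :=
  (mulOp (phase K π⁻¹) (memLp_phase K π⁻¹)).comp
    (Lp.compMeasurePreservingₗᵢ ℂ (fun t : Fin n → T => t ∘ π)
      (measurePreserving_perm π)).toContinuousLinearMap

theorem coeFn_Psi {n : ℕ} (π : Equiv.Perm (Fin n)) (f : NSpace σ n) :
    Psi K π f =ᵐ[Measure.pi fun _ : Fin n => σ] fun t => phase K π⁻¹ t * f (t ∘ π) := by
  have h1 := coeFn_mulOp (phase K π⁻¹) (memLp_phase K π⁻¹)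
    (Lp.compMeasurePreserving (fun t : Fin n → T => t ∘ π) (measurePreserving_perm π) f)
  have h2 := Lp.coeFn_compMeasurePreserving f (measurePreserving_perm (σ := σ) π)
  filter_upwards [h1, h2] with t ht1 ht2
  rw [ht2] at ht1
  exact ht1

theorem Psi_one {n : ℕ} : Psi K (1 : Equiv.Perm (Fin n)) = 1 := by
  refine ContinuousLinearMap.ext fun f => Lp.ext ?_
  filter_upwards [coeFn_Psi K 1 f] with t ht
  rw [ht, inv_one, phase_one, one_mul]
  rfl

theorem Psi_mul {n : ℕ} (π ρ : Equiv.Perm (Fin n)) : Psi K (π * ρ) = Psi K π * Psi K ρ := by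
  refine ContinuousLinearMap.ext fun f => Lp.ext ?_
  have h := (measurePreserving_perm (σ := σ) π).quasiMeasurePreserving.ae (coeFn_Psi K ρ f)
  filter_upwards [coeFn_Psi K (π * ρ) f, coeFn_Psi K π (Psi K ρ f), h] with t h1 h2 h3
  have h4 : (Psi K π * Psi K ρ) f = Psi K π (Psi K ρ f) := rfl
  rw [h1, h4, h2, h3, mul_inv_rev, phase_mul, inv_inv, mul_assoc]
  rfl

theorem Psi_swap {n : ℕ} (j : Fin n) (f : NSpace σ (n + 1)) :
    Psi K (Equiv.swap j.castSucc j.succ) f =ᵐ[Measure.pi fun _ : Fin (n + 1) => σ]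
      fun t => K.qfun (t j.castSucc) (t j.succ) * f (t ∘ Equiv.swap j.castSucc j.succ) := by
  filter_upwards [coeFn_Psi K (Equiv.swap j.castSucc j.succ) f] with t ht
  rw [ht, Equiv.swap_inv, phase_swap]

/-- The `Q`-symmetrization operator `P_n = (1 / n!) ∑_π Ψ_π`. -/
def symmetrization (n : ℕ) : NSpace σ n →L[ℂ] NSpace σ n :=
  ((n ! : ℂ)⁻¹) • ∑ π : Equiv.Perm (Fin n), Psi K π

theorem Psi_mul_symmetrization {n : ℕ} (π : Equiv.Perm (Fin n)) :
    Psi K π * symmetrization K n = symmetrization K n := by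
  unfold symmetrization
  rw [mul_smul_comm, Finset.mul_sum]
  congr 1
  simp_rw [← Psi_mul]
  exact Fintype.sum_equiv (Equiv.mulLeft π) _ _ fun _ => rfl

theorem isIdempotentElem_symmetrization (n : ℕ) : IsIdempotentElem (symmetrization K n) := by
  unfold IsIdempotentElem
  conv_lhs => lhs; unfold symmetrization
  rw [smul_mul_assoc, Finset.sum_mul]
  simp_rw [Psi_mul_symmetrization]
  rw [Finset.sum_const, Finset.card_univ, Fintype.card_perm, Fintype.card_fin,
    ← Nat.cast_smul_eq_nsmul ℂ, smul_smul, inv_mul_cancel₀, one_smul]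
  exact_mod_cast Nat.factorial_ne_zero n

/-- The `n`-th `Q`-symmetric tensor power of `L²(T → ℂ, σ)`: the range of `P_n`. -/
abbrev QSymm (n : ℕ) : Submodule ℂ (NSpace σ n) :=
  LinearMap.range (symmetrization K n).toLinearMap

instance (n : ℕ) : CompleteSpace (QSymm K n) :=
  (ContinuousLinearMap.IsIdempotentElem.isClosed_range
    (isIdempotentElem_symmetrization K n)).completeSpace_coe

/-- The `Q`-symmetrization operator as a map onto the `Q`-symmetric tensor power. -/
def toQSymm (n : ℕ) : NSpace σ n →L[ℂ] QSymm K n :=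
  (symmetrization K n).codRestrict (QSymm K n) fun f => ⟨f, rfl⟩

theorem mem_QSymm_iff {n : ℕ} (f : NSpace σ n) :
    f ∈ QSymm K n ↔ ∀ π : Equiv.Perm (Fin n), Psi K π f = f := by
  constructor
  · rintro ⟨g, rfl⟩ π
    exact DFunLike.congr_fun (Psi_mul_symmetrization K π) g
  · intro h
    refine ⟨f, ?_⟩
    have : symmetrization K n f = f := by
      unfold symmetrization
      rw [_root_.smul_apply, _root_.sum_apply]
      simp_rw [h]
      rw [Finset.sum_const, Finset.card_univ, Fintype.card_perm, Fintype.card_fin,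
        ← Nat.cast_smul_eq_nsmul ℂ, smul_smul, inv_mul_cancel₀, one_smul]
      exact_mod_cast Nat.factorial_ne_zero n
    exact this

/-! ### Tensor product with a one-particle vector -/

theorem measurePreserving_headTail (n : ℕ) :
    MeasurePreserving (fun t : Fin (n + 1) → T => (t 0, Fin.tail t))
      (Measure.pi fun _ : Fin (n + 1) => σ) (σ.prod (Measure.pi fun _ : Fin n => σ)) := by
  have h := measurePreserving_piFinSuccAbove (α := fun _ : Fin (n + 1) => T) (fun _ => σ) 0
  exact h

theorem memLp_tensor_prod {n : ℕ} (h : Lp ℂ 2 σ) (f : NSpace σ n) :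
    MemLp (fun p : T × (Fin n → T) => h p.1 * f p.2) 2
      (σ.prod (Measure.pi fun _ : Fin n => σ)) := by
  rw [memLp_two_iff_integrable_sq_norm (aesm_tensor h f)]
  simp_rw [norm_mul, mul_pow]
  exact ((memLp_two_iff_integrable_sq_norm (Lp.aestronglyMeasurable h)).1 (Lp.memLp h)).mul_prod
    ((memLp_two_iff_integrable_sq_norm (Lp.aestronglyMeasurable f)).1 (Lp.memLp f))

theorem memLp_tensor {n : ℕ} (h : Lp ℂ 2 σ) (f : NSpace σ n) :
    MemLp (fun t : Fin (n + 1) → T => h (t 0) * f (Fin.tail t)) 2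
      (Measure.pi fun _ : Fin (n + 1) => σ) :=
  (memLp_tensor_prod h f).comp_measurePreserving (measurePreserving_headTail n)

theorem norm_tensor {n : ℕ} (h : Lp ℂ 2 σ) (f : NSpace σ n) :
    ‖(memLp_tensor h f).toLp _‖ = ‖h‖ * ‖f‖ := by
  have sq : ∀ {X : Type _} [MeasurableSpace X] {μ : Measure X} (g : Lp ℂ 2 μ),
      ‖g‖ ^ 2 = ∫ x, ‖g x‖ ^ 2 ∂μ := by
    intro X _ μ g
    have h1 : ‖g‖ ^ 2 = RCLike.re (inner ℂ g g) := (inner_self_eq_norm_sq (𝕜 := ℂ) g).symm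
    rw [h1, L2.inner_def, ← integral_re (L2.integrable_inner g g)]
    exact integral_congr_ae (Eventually.of_forall fun x => inner_self_eq_norm_sq (𝕜 := ℂ) (g x))
  have key : ‖(memLp_tensor h f).toLp _‖ ^ 2 = (‖h‖ * ‖f‖) ^ 2 := by
    rw [mul_pow, sq, sq, sq, ← integral_prod_mul,
      ← (measurePreserving_headTail (σ := σ) n).integral_comp
        (MeasurableEquiv.piFinSuccAbove (fun _ : Fin (n + 1) => T) 0).measurableEmbedding]
    refine integral_congr_ae ?_
    filter_upwards [(memLp_tensor h f).coeFn_toLp] with t ht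
    rw [ht, norm_mul, mul_pow]
  exact (pow_left_inj₀ (norm_nonneg _) (by positivity) two_ne_zero).1 key

/-- Tensoring from the left with `h ∈ L²(T → ℂ, σ)`:
`(h ⊗ f) (t₁, …, t_{n+1}) = h (t₁) f (t₂, …, t_{n+1})`. -/
def tensorLeft (n : ℕ) (h : Lp ℂ 2 σ) : NSpace σ n →L[ℂ] NSpace σ (n + 1) :=
  LinearMap.mkContinuous
    { toFun := fun f => (memLp_tensor h f).toLp
        (fun t : Fin (n + 1) → T => h (t 0) * f (Fin.tail t))
      map_add' := by
        intro f g
        rw [← MemLp.toLp_add]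
        apply MemLp.toLp_congr
        have hq := (Measure.quasiMeasurePreserving_snd (μ := σ)
          (ν := Measure.pi fun _ : Fin n => σ)).comp
          (measurePreserving_headTail (σ := σ) n).quasiMeasurePreserving
        filter_upwards [hq.ae (Lp.coeFn_add f g)] with t ht
        simp only [Function.comp_apply, Pi.add_apply] at ht ⊢
        rw [ht, mul_add]
      map_smul' := by
        intro c f
        rw [RingHom.id_apply, ← MemLp.toLp_const_smul]
        apply MemLp.toLp_congr
        have hq := (Measure.quasiMeasurePreserving_snd (μ := σ)
          (ν := Measure.pi fun _ : Fin n => σ)).comp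
          (measurePreserving_headTail (σ := σ) n).quasiMeasurePreserving
        filter_upwards [hq.ae (Lp.coeFn_smul c f)] with t ht
        simp only [Function.comp_apply, Pi.smul_apply, smul_eq_mul] at ht ⊢
        rw [ht]
        ring }
    ‖h‖ fun f => (norm_tensor h f).le

/-! ### The Fock space of finite sequences and the fundamental operators -/

/-- The space of finite sequences `(f⁽⁰⁾, f⁽¹⁾, …, f⁽ⁿ⁾, 0, 0, …)` in the `Q`-Fock space,
`f⁽ⁱ⁾` being a `Q`-symmetric function of `i` variables. -/
abbrev FockFin : Type _ := ⨁ n, QSymm K n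

/-- The inner product of the `Q`-Fock space `⨁ₙ n! H^{⊛ n}` on finite sequences,
`∑ₙ n! ⟪f⁽ⁿ⁾, g⁽ⁿ⁾⟫`, conjugate-linear in the first argument, as a linear map of the second. -/
def fockInner (F : FockFin K) : FockFin K →ₗ[ℂ] ℂ :=
  DirectSum.toModule ℂ ℕ ℂ fun n => (n ! : ℂ) • (innerSL ℂ (F n)).toLinearMap

theorem memLp_vacuumFun (σ : Measure T) :
    MemLp (fun _ : Fin 0 → T => (1 : ℂ)) 2 (Measure.pi fun _ : Fin 0 => σ) := by
  rw [Measure.pi_of_empty]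
  exact memLp_const 1

/-- The constant function `1` of no variables. -/
def vacuumFun (σ : Measure T) : NSpace σ 0 :=
  (memLp_vacuumFun σ).toLp _

theorem mem_QSymm_zero (f : NSpace σ 0) : f ∈ QSymm K 0 := by
  rw [mem_QSymm_iff]
  intro π
  rw [Subsingleton.elim π 1, Psi_one]
  rfl

/-- The vacuum vector `Ω = (1, 0, 0, …)`. -/
def vacuum : FockFin K :=
  DirectSum.lof ℂ ℕ (fun n => QSymm K n) 0 ⟨vacuumFun σ, mem_QSymm_zero K _⟩

/-- Creation on `n`-particle vectors: `f ↦ h ⊛ f = P_{n+1} (h ⊗ f)`. -/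
def creationN (h : Lp ℂ 2 σ) (n : ℕ) : QSymm K n →L[ℂ] QSymm K (n + 1) :=
  (toQSymm K (n + 1)).comp ((tensorLeft n h).comp (QSymm K n).subtypeL)

/-- The creation operator `a⁺(h)`. -/
def creation (h : Lp ℂ 2 σ) : Module.End ℂ (FockFin K) :=
  DirectSum.toModule ℂ ℕ _ fun n =>
    (DirectSum.lof ℂ ℕ (fun n => QSymm K n) (n + 1)).comp (creationN K h n).toLinearMap

/-- Annihilation on `n`-particle vectors, with values in the `(n - 1)`-particle vectors. The
factor `n = n! / (n - 1)!` comes from the weights in the inner product of the Fock space. -/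
def annihilationN (h : Lp ℂ 2 σ) : (n : ℕ) → QSymm K n →ₗ[ℂ] FockFin K
  | 0 => 0
  | n + 1 => (DirectSum.lof ℂ ℕ (fun n => QSymm K n) n).comp
      (((n + 1 : ℕ) : ℂ) • (ContinuousLinearMap.adjoint (creationN K h n)).toLinearMap)

/-- The annihilation operator `a⁻(h)`: the adjoint of `a⁺(h)` with respect to the inner product
of the Fock space, see `fockInner_creation`. -/
def annihilation (h : Lp ℂ 2 σ) : Module.End ℂ (FockFin K) :=
  DirectSum.toModule ℂ ℕ _ (annihilationN K h)

theorem fockInner_lof (F : FockFin K) (n : ℕ) (g : QSymm K n) :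
    fockInner K F (DirectSum.lof ℂ ℕ (fun n => QSymm K n) n g) = (n ! : ℂ) * inner ℂ (F n) g := by
  simp [fockInner]

theorem creation_apply_zero (h : Lp ℂ 2 σ) (F : FockFin K) : creation K h F 0 = 0 := by
  induction F using DirectSum.induction_on with
  | zero => simp
  | of n f =>
    rw [← DirectSum.lof_eq_of ℂ, creation, DirectSum.toModule_lof, LinearMap.comp_apply,
      DirectSum.lof_eq_of, DirectSum.of_eq_of_ne _ _ _ (by simp)]
  | add F G hF hG => rw [map_add, DirectSum.add_apply, hF, hG, add_zero]

theorem creation_apply_succ (h : Lp ℂ 2 σ) (F : FockFin K) (n : ℕ) :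
    creation K h F (n + 1) = creationN K h n (F n) := by
  induction F using DirectSum.induction_on with
  | zero => simp
  | of m f =>
    rw [← DirectSum.lof_eq_of ℂ, creation, DirectSum.toModule_lof, LinearMap.comp_apply]
    by_cases hm : m = n
    · subst hm
      rw [DirectSum.lof_apply, DirectSum.lof_apply]
      rfl
    · rw [DirectSum.lof_eq_of, DirectSum.lof_eq_of, DirectSum.of_eq_of_ne _ _ _ (by omega),
        DirectSum.of_eq_of_ne _ _ _ (by omega), map_zero]
  | add F G hF hG => rw [map_add, DirectSum.add_apply, DirectSum.add_apply, hF, hG, map_add]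

/-- `a⁻(h)` is the adjoint of `a⁺(h)`. -/
theorem fockInner_creation (h : Lp ℂ 2 σ) (F G : FockFin K) :
    fockInner K (creation K h F) G = fockInner K F (annihilation K h G) := by
  induction G using DirectSum.induction_on with
  | zero => simp
  | of n g =>
    rw [← DirectSum.lof_eq_of ℂ, fockInner_lof, annihilation, DirectSum.toModule_lof]
    cases n with
    | zero => rw [creation_apply_zero, inner_zero_left, mul_zero, annihilationN,
        LinearMap.zero_apply, map_zero]
    | succ n =>
      rw [annihilationN, LinearMap.comp_apply, fockInner_lof, creation_apply_succ,
        LinearMap.smul_apply, inner_smul_right, ContinuousLinearMap.coe_coe,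
        ContinuousLinearMap.adjoint_inner_right, Nat.factorial_succ]
      push_cast
      ring
  | add F G hF hG => rw [map_add, map_add, map_add, hF, hG]

theorem fockInner_add_left (F F' G : FockFin K) :
    fockInner K (F + F') G = fockInner K F G + fockInner K F' G := by
  induction G using DirectSum.induction_on with
  | zero => simp
  | of n g =>
    rw [← DirectSum.lof_eq_of ℂ, fockInner_lof, fockInner_lof, fockInner_lof,
      DirectSum.add_apply, inner_add_left, mul_add]
  | add G H hG hH => rw [map_add, map_add, map_add, hG, hH]; ring

theorem fockInner_conj (F G : FockFin K) : conj (fockInner K F G) = fockInner K G F := by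
  induction F using DirectSum.induction_on with
  | zero =>
    have h : fockInner K 0 G = 0 := by
      have := fockInner_add_left K 0 0 G
      rw [add_zero] at this
      simpa using this
    rw [h]
    simp
  | of m f =>
    induction G using DirectSum.induction_on with
    | zero =>
      have := fockInner_add_left K 0 0 (DirectSum.of (fun n => QSymm K n) m f)
      rw [add_zero] at this
      have h0 : fockInner K 0 (DirectSum.of (fun n => QSymm K n) m f) = 0 := by simpa using this
      rw [map_zero, map_zero, h0]
    | of n g =>
      rw [← DirectSum.lof_eq_of ℂ, ← DirectSum.lof_eq_of ℂ, fockInner_lof, fockInner_lof,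
        DirectSum.lof_eq_of, DirectSum.lof_eq_of]
      by_cases h : m = n
      · subst h
        rw [DirectSum.of_eq_same, DirectSum.of_eq_same, map_mul, Complex.conj_natCast]
        exact congrArg _ (inner_conj_symm (𝕜 := ℂ) g f)
      · rw [DirectSum.of_eq_of_ne _ _ _ (Ne.symm h), DirectSum.of_eq_of_ne _ _ _ h]
        simp
    | add G H hG hH => rw [map_add, map_add, hG, hH, fockInner_add_left]
  | add F F' hF hF' => rw [fockInner_add_left, map_add, hF, hF', map_add]

/-- Multiplication by the symmetric function `h (t₁) + … + h (tₙ)` maps `Q`-symmetric functions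
to `Q`-symmetric functions. -/
theorem mulOp_sum_mem {h : T → ℂ} (hh : Measurable h) {C : ℝ} (hC : ∀ t, ‖h t‖ ≤ C) {n : ℕ}
    (f : NSpace σ n) (hf : f ∈ QSymm K n) : mulOp _ (memLp_sum hh hC n) f ∈ QSymm K n := by
  rw [mem_QSymm_iff] at hf ⊢
  intro π
  apply Lp.ext
  have hm := coeFn_mulOp _ (memLp_sum (σ := σ) hh hC n) f
  have hp := coeFn_Psi K π f
  rw [hf π] at hp
  filter_upwards [coeFn_Psi K π (mulOp _ (memLp_sum hh hC n) f), hm, hp,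
    (measurePreserving_perm (σ := σ) π).quasiMeasurePreserving.ae hm] with t h1 h2 h3 h4
  rw [h1, h4, h2]
  conv_rhs => rw [h3]
  have : ∑ i, h ((t ∘ π) i) = ∑ i, h (t i) := Equiv.sum_comp π fun i => h (t i)
  rw [this]
  ring

/-- The neutral operator on `n`-particle vectors:
`(a⁰(h) f) (t₁, …, tₙ) = (h (t₁) + … + h (tₙ)) f (t₁, …, tₙ)`. -/
def neutralN {h : T → ℂ} (hh : Measurable h) {C : ℝ} (hC : ∀ t, ‖h t‖ ≤ C) (n : ℕ) :
    QSymm K n →ₗ[ℂ] QSymm K n :=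
  (mulOp _ (memLp_sum hh hC n)).toLinearMap.restrict fun f hf => mulOp_sum_mem K hh hC f hf

/-- The neutral (preservation) operator `a⁰(h)` of a bounded measurable function `h`. -/
def neutral {h : T → ℂ} (hh : Measurable h) {C : ℝ} (hC : ∀ t, ‖h t‖ ≤ C) :
    Module.End ℂ (FockFin K) :=
  DirectSum.toModule ℂ ℕ _ fun n =>
    (DirectSum.lof ℂ ℕ (fun n => QSymm K n) n).comp (neutralN K hh hC n)

theorem neutral_apply {h : T → ℂ} (hh : Measurable h) {C : ℝ} (hC : ∀ t, ‖h t‖ ≤ C)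
    (F : FockFin K) (n : ℕ) : neutral K hh hC F n = neutralN K hh hC n (F n) := by
  induction F using DirectSum.induction_on with
  | zero => simp
  | of m f =>
    rw [← DirectSum.lof_eq_of ℂ, neutral, DirectSum.toModule_lof, LinearMap.comp_apply]
    by_cases hm : m = n
    · subst hm
      rw [DirectSum.lof_apply, DirectSum.lof_apply]
    · rw [DirectSum.lof_eq_of, DirectSum.lof_eq_of, DirectSum.of_eq_of_ne _ _ _ (by omega),
        DirectSum.of_eq_of_ne _ _ _ (by omega), map_zero]
  | add F G hF hG => rw [map_add, DirectSum.add_apply, DirectSum.add_apply, hF, hG, map_add]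

theorem inner_mulOp {X : Type*} [MeasurableSpace X] {μ : Measure X} {g : X → ℂ}
    (hg : MemLp g ∞ μ) (hr : ∀ x, conj (g x) = g x) (f f' : Lp ℂ 2 μ) :
    inner ℂ (mulOp g hg f) f' = inner ℂ f (mulOp g hg f') := by
  rw [L2.inner_def, L2.inner_def]
  refine integral_congr_ae ?_
  filter_upwards [coeFn_mulOp g hg f, coeFn_mulOp g hg f'] with x h1 h2
  rw [h1, h2, RCLike.inner_apply, RCLike.inner_apply, map_mul, hr]
  ring

/-- `a⁰(h)` is Hermitian for real-valued `h`. -/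
theorem fockInner_neutral {h : T → ℂ} (hh : Measurable h) {C : ℝ} (hC : ∀ t, ‖h t‖ ≤ C)
    (hr : ∀ t, conj (h t) = h t) (F G : FockFin K) :
    fockInner K (neutral K hh hC F) G = fockInner K F (neutral K hh hC G) := by
  induction G using DirectSum.induction_on with
  | zero => simp
  | of n g =>
    rw [← DirectSum.lof_eq_of ℂ, fockInner_lof, neutral_apply, neutral, DirectSum.toModule_lof,
      LinearMap.comp_apply, fockInner_lof]
    congr 1
    exact inner_mulOp (memLp_sum hh hC n) (fun t => by rw [map_sum]; simp_rw [hr]) _ _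
  | add G H hG hH => rw [map_add, map_add, map_add, hG, hH]

end Operators

section Field

/-- The space `B₀(T)` of real-valued bounded Borel functions on `T` with compact support. -/
structure TestFunction (T : Type*) [TopologicalSpace T] [MeasurableSpace T] where
  /-- the function -/
  toFun : T → ℝ
  measurable : Measurable toFun
  bounded : ∃ C : ℝ, ∀ t, |toFun t| ≤ C
  hasCompactSupport : HasCompactSupport toFun

variable {T : Type*} [TopologicalSpace T] [MeasurableSpace T]

/-- A test function, regarded as a complex-valued function. -/
def TestFunction.toComplex (f : TestFunction T) (t : T) : ℂ := (f.toFun t : ℂ)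

theorem TestFunction.measurable_toComplex (f : TestFunction T) : Measurable f.toComplex :=
  Complex.measurable_ofReal.comp f.measurable

theorem TestFunction.norm_toComplex_le (f : TestFunction T) (t : T) :
    ‖f.toComplex t‖ ≤ f.bounded.choose := by
  rw [TestFunction.toComplex, Complex.norm_real, Real.norm_eq_abs]
  exact f.bounded.choose_spec t

theorem TestFunction.memLp (f : TestFunction T) (σ : Measure T) [IsFiniteMeasureOnCompacts σ] :
    MemLp f.toComplex 2 σ :=
  HasCompactSupport.memLp_of_bound (f.hasCompactSupport.comp_left Complex.ofReal_zero)
    f.measurable_toComplex.aestronglyMeasurable _ (Eventually.of_forall f.norm_toComplex_le)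

variable {σ : Measure T} [SigmaFinite σ] [IsFiniteMeasureOnCompacts σ] (K : StatisticsKernel σ)

/-- The operator `⟨f, ω⟩ = a⁺(f) + λ a⁰(f) + a⁻(f)`. -/
def field (lam : ℝ) (f : TestFunction T) : Module.End ℂ (FockFin K) :=
  creation K ((f.memLp σ).toLp f.toComplex) +
    (lam : ℂ) • neutral K f.measurable_toComplex f.norm_toComplex_le +
    annihilation K ((f.memLp σ).toLp f.toComplex)

/-- `⟨f, ω⟩` is Hermitian. -/
theorem fockInner_field (lam : ℝ) (f : TestFunction T) (F G : FockFin K) :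
    fockInner K (field K lam f F) G = fockInner K F (field K lam f G) := by
  have h1 := fockInner_creation K ((f.memLp σ).toLp f.toComplex)
  have h2 := fockInner_neutral K f.measurable_toComplex f.norm_toComplex_le
    (fun t => Complex.conj_ofReal _)
  have h3 : ∀ F G, fockInner K (annihilation K ((f.memLp σ).toLp f.toComplex) F) G =
      fockInner K F (creation K ((f.memLp σ).toLp f.toComplex) G) := by
    intro F G
    rw [← fockInner_conj, ← h1, fockInner_conj]
  have h4 : ∀ F G : FockFin K, fockInner K ((lam : ℂ) • F) G = (lam : ℂ) * fockInner K F G := by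
    intro F G
    rw [← fockInner_conj, map_smul, smul_eq_mul, map_mul, fockInner_conj, Complex.conj_ofReal]
  simp only [field, LinearMap.add_apply, LinearMap.smul_apply, fockInner_add_left, map_add, h1,
    h3, h4, h2, map_smul, smul_eq_mul]
  ring

/-- The unital algebra `𝒫` generated by the operators `⟨f, ω⟩`, `f ∈ B₀(T)`. These operators being
Hermitian (see `fockInner_field`), it is also the unital `*`-algebra generated by them. -/
def polyAlgebra (lam : ℝ) : Subalgebra ℂ (Module.End ℂ (FockFin K)) :=
  Algebra.adjoin ℂ (Set.range (field K lam))

/-- The vacuum state `τ(p) = (p Ω, Ω)`. -/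
def vacuumState (p : Module.End ℂ (FockFin K)) : ℂ :=
  fockInner K (vacuum K) (p (vacuum K))

end Field

end QFock

end

noncomputable section

namespace QFock

/-! ### Functions on a product space with vanishing integrals over rectangles -/

/-! Sufficiency is a commutant argument. Write X(g) for the field `⟨g, ω⟩`. If every X(g) has a
Hermitian partner Y(g) which commutes with all fields and satisfies Y(g)Ω = X(g)Ω, then ⟨Ω, p X(g)Ω⟩
= ⟨Ω, Y(g) pΩ⟩ = ⟨Y(g)Ω, pΩ⟩ = ⟨Ω, X(g) pΩ⟩, and cyclicity passes from the generators to the whole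
algebra (`vacuumState_mul_comm`). The partner is the field which creates and annihilates from the
right. For real `Q`, carrying a new particle s from the last place to the first costs the factor ∏
Q(s, tⱼ), so creation from the right is creation from the left followed by multiplication by such a
product (`Twist.prod`, `rightCreationN`).

Left and right creation commute because the phase of the transposition of the first two variables
cancels one factor of the twist (`Psi_swap_twistOp`). For the mixed terms the symmetrization is
split along the cosets of the stabilizer of the first index: the term without exchange is symmetric
under interchanging the roles of the real functions f and g, and the exchange terms reproduce the
products in which annihilation comes first (`raise_lower_comm`). The neutral part is absent when λ =
0; when `Q` = 1, left and right creation coincide and [a⁰(f), a⁺(g)] = a⁺(fg) is symmetric in f and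
g.

Necessity comes from two moments of f = 1_B and g = 1_A with A and B disjoint. Put u = g ⊛ f and v =
f ⊛ g, so that ⟨u, u⟩ = ∫_{A×B} 1 and ⟨u, v⟩ = ∫_{A×B} Q. Cyclicity of the word fgfg gives ⟨u, v⟩ =
⟨v, u⟩ (`fourth_moment_of_tracial`), and cyclicity of fgfgf gives λ⟨u, u⟩ = λ⟨u, v⟩
(`fifth_moment_of_tracial`). Products of disjoint sets determine a function almost everywhere off
the diagonal, so `Q` is real, and `Q` = 1 if λ ≠ 0. A real `Q` of modulus one takes the values ±1.
-/

theorem Integrable.ae_eq_zero_of_forall_rectangle {X Y : Type*} [MeasurableSpace X]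
    [MeasurableSpace Y] {μ : Measure (X × Y)} {G : X × Y → ℂ} (hG : Integrable G μ)
    (h : ∀ A B, MeasurableSet A → MeasurableSet B → ∫ p in A ×ˢ B, G p ∂μ = 0) :
    G =ᵐ[μ] 0 := by
  suffices H : ∀ s, MeasurableSet s → ∫ p in s, G p ∂μ = 0 from
    hG.ae_eq_zero_of_forall_setIntegral_eq_zero fun s hs _ => H s hs
  intro s hs
  -- Dynkin's argument: the rectangles are a π-system generating the product σ-algebra, and the
  -- whole space is itself a rectangle, which settles complements.
  induction s, hs using MeasurableSpace.induction_on_inter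
    (s := Set.image2 (· ×ˢ ·) {s : Set X | MeasurableSet s} {t : Set Y | MeasurableSet t}) with
  | h_eq => exact generateFrom_prod.symm
  | h_inter => exact isPiSystem_prod
  | empty => simp
  | basic s hs =>
    obtain ⟨A, hA, B, hB, rfl⟩ := hs
    exact h A B hA hB
  | compl s hs ih =>
    have h1 := integral_add_compl hs hG
    have h2 := h Set.univ Set.univ .univ .univ
    rw [Set.univ_prod_univ, setIntegral_univ] at h2
    rwa [ih, h2, zero_add] at h1
  | iUnion f hd hm ih =>
    rw [integral_iUnion hm hd hG.integrableOn]
    simp [ih]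

theorem ae_eq_zero_of_forall_finite_rectangle {X Y : Type*} [MeasurableSpace X]
    [MeasurableSpace Y] {μ : Measure X} {ν : Measure Y} [SigmaFinite μ] [SigmaFinite ν]
    {G : X × Y → ℂ}
    (hG : ∀ A B, MeasurableSet A → MeasurableSet B → μ A < ∞ → ν B < ∞ →
      IntegrableOn G (A ×ˢ B) (μ.prod ν))
    (h : ∀ A B, MeasurableSet A → MeasurableSet B → μ A < ∞ → ν B < ∞ →
      ∫ p in A ×ˢ B, G p ∂μ.prod ν = 0) :
    G =ᵐ[μ.prod ν] 0 := by
  have key : ∀ m n : ℕ, ∀ᵐ p ∂μ.prod ν,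
      p ∈ spanningSets μ m ×ˢ spanningSets ν n → G p = 0 := by
    intro m n
    have hm := measurableSet_spanningSets μ m
    have hn := measurableSet_spanningSets ν n
    have hm' := measure_spanningSets_lt_top μ m
    have hn' := measure_spanningSets_lt_top ν n
    rw [← ae_restrict_iff' (hm.prod hn)]
    refine Integrable.ae_eq_zero_of_forall_rectangle (hG _ _ hm hn hm' hn') fun A B hA hB => ?_
    rw [Measure.restrict_restrict (hA.prod hB), Set.prod_inter_prod]
    exact h _ _ (hA.inter hm) (hB.inter hn) (measure_mono Set.inter_subset_right |>.trans_lt hm')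
      (measure_mono Set.inter_subset_right |>.trans_lt hn')
  have := ae_all_iff.2 fun m => ae_all_iff.2 (key m)
  filter_upwards [this] with p hp
  have h1 : p.1 ∈ ⋃ m, spanningSets μ m := by rw [iUnion_spanningSets]; trivial
  have h2 : p.2 ∈ ⋃ m, spanningSets ν m := by rw [iUnion_spanningSets]; trivial
  obtain ⟨m, hm⟩ := Set.mem_iUnion.1 h1
  obtain ⟨n, hn⟩ := Set.mem_iUnion.1 h2
  exact hp m n ⟨hm, hn⟩

/-! ### Tensoring from the left -/

section Tensor

variable {T : Type*} [MeasurableSpace T] {σ : Measure T} [SigmaFinite σ]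

theorem coeFn_tensorLeft {n : ℕ} (h : Lp ℂ 2 σ) (f : NSpace σ n) :
    tensorLeft n h f =ᵐ[Measure.pi fun _ : Fin (n + 1) => σ]
      fun t => h (t 0) * f (Fin.tail t) :=
  (memLp_tensor h f).coeFn_toLp

theorem integral_headTail {n : ℕ} (G : T × (Fin n → T) → ℂ) :
    ∫ t : Fin (n + 1) → T, G (t 0, Fin.tail t) ∂(Measure.pi fun _ : Fin (n + 1) => σ) =
      ∫ p, G p ∂σ.prod (Measure.pi fun _ : Fin n => σ) :=
  (measurePreserving_headTail (σ := σ) n).integral_comp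
    (MeasurableEquiv.piFinSuccAbove (fun _ : Fin (n + 1) => T) 0).measurableEmbedding G

theorem inner_tensorLeft {n : ℕ} (f g : Lp ℂ 2 σ) (x y : NSpace σ n) :
    inner ℂ (tensorLeft n f x) (tensorLeft n g y) = inner ℂ f g * inner ℂ x y := by
  rw [L2.inner_def, L2.inner_def, L2.inner_def, ← integral_prod_mul, ← integral_headTail]
  refine integral_congr_ae ?_
  filter_upwards [coeFn_tensorLeft f x, coeFn_tensorLeft g y] with t h1 h2
  rw [h1, h2]
  simp only [RCLike.inner_apply, map_mul]
  ring

/-- Against tensor products of indicator functions of sets of finite measure, the inner product is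
the integral of `w` over a rectangle. -/
theorem eq_zero_of_forall_inner_tensorLeft {n : ℕ} {w : NSpace σ (n + 1)}
    (hw : ∀ h y, inner ℂ (tensorLeft n h y) w = 0) : w = 0 := by
  set e := MeasurableEquiv.piFinSuccAbove (fun _ : Fin (n + 1) => T) 0
  have he : MeasurePreserving e (Measure.pi fun _ : Fin (n + 1) => σ)
    (σ.prod (Measure.pi fun _ : Fin n => σ)) := measurePreserving_headTail n
  have hes := he.symm
  have hL : MemLp (w ∘ e.symm) 2 (σ.prod (Measure.pi fun _ : Fin n => σ)) :=
    (Lp.memLp w).comp_measurePreserving hes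
  have h0 : w ∘ e.symm =ᵐ[σ.prod (Measure.pi fun _ : Fin n => σ)] 0 := by
    refine ae_eq_zero_of_forall_finite_rectangle (fun A B hA hB hA' hB' => ?_)
      fun A B hA hB hA' hB' => ?_
    · have : IsFiniteMeasure ((σ.prod (Measure.pi fun _ : Fin n => σ)).restrict (A ×ˢ B)) := by
        refine ⟨?_⟩
        rw [Measure.restrict_apply_univ, Measure.prod_prod]
        exact ENNReal.mul_lt_top hA' hB'
      exact (hL.restrict (A ×ˢ B)).integrable one_le_two
    · have h1 := hw (indicatorConstLp 2 hA hA'.ne 1) (indicatorConstLp 2 hB hB'.ne 1)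
      rw [L2.inner_def] at h1
      rw [← integral_indicator (hA.prod hB), ← integral_headTail, ← h1]
      refine integral_congr_ae ?_
      have q1 := (Measure.quasiMeasurePreserving_fst (μ := σ)
          (ν := Measure.pi fun _ : Fin n => σ)).comp
          (measurePreserving_headTail (σ := σ) n).quasiMeasurePreserving
      have q2 := (Measure.quasiMeasurePreserving_snd (μ := σ)
          (ν := Measure.pi fun _ : Fin n => σ)).comp
          (measurePreserving_headTail (σ := σ) n).quasiMeasurePreserving
      filter_upwards [coeFn_tensorLeft (indicatorConstLp 2 hA hA'.ne 1)
        (indicatorConstLp 2 hB hB'.ne 1), q1.ae (indicatorConstLp_coeFn (p := 2) (hs := hA)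
          (hμs := hA'.ne) (c := (1 : ℂ))), q2.ae (indicatorConstLp_coeFn (p := 2) (hs := hB)
          (hμs := hB'.ne) (c := (1 : ℂ)))] with t t1 t2 t3
      simp only [Function.comp_apply] at t2 t3
      have hte : e.symm (t 0, Fin.tail t) = t := e.symm_apply_apply t
      rw [t1, t2, t3]
      simp only [Set.indicator, Set.mem_prod, Function.comp_apply, hte, RCLike.inner_apply]
      by_cases ha : t 0 ∈ A <;> by_cases hb : Fin.tail t ∈ B <;> simp [ha, hb]
  apply Lp.ext
  filter_upwards [he.quasiMeasurePreserving.ae h0, Lp.coeFn_zero ℂ 2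
    (Measure.pi fun _ : Fin (n + 1) => σ)] with t ht ht'
  rw [ht']
  simpa using ht

/-- The vectors f ⊗ y are total, since nothing but zero is orthogonal to all of them. Operator
identities can therefore be checked on such vectors. -/
theorem ext_of_forall_tensorLeft {n : ℕ} {E : Type*} [NormedAddCommGroup E]
    [InnerProductSpace ℂ E] {F G : NSpace σ (n + 1) →L[ℂ] E}
    (h : ∀ f y, F (tensorLeft n f y) = G (tensorLeft n f y)) : F = G := by
  set S : Submodule ℂ (NSpace σ (n + 1)) :=
    Submodule.span ℂ (Set.range fun p : Lp ℂ 2 σ × NSpace σ n => tensorLeft n p.1 p.2)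
  have hS : S.topologicalClosure = ⊤ := by
    rw [Submodule.topologicalClosure_eq_top_iff, Submodule.eq_bot_iff]
    intro w hw
    refine eq_zero_of_forall_inner_tensorLeft fun f y => ?_
    exact (Submodule.mem_orthogonal _ _).1 hw _ (Submodule.subset_span ⟨(f, y), rfl⟩)
  refine ContinuousLinearMap.ext_on
    (s := Set.range fun p : Lp ℂ 2 σ × NSpace σ n => tensorLeft n p.1 p.2) ?_ ?_
  · exact Submodule.dense_iff_topologicalClosure_eq_top.2 hS
  · rintro _ ⟨p, rfl⟩
    exact h p.1 p.2

end Tensor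

/-! ### The unitary action of the symmetric group -/

theorem norm_mulOp_apply {X : Type*} [MeasurableSpace X] {μ : Measure X} {g : X → ℂ}
    (hg : MemLp g ∞ μ) (h : ∀ x, ‖g x‖ = 1) (f : Lp ℂ 2 μ) : ‖mulOp g hg f‖ = ‖f‖ := by
  apply le_antisymm <;> apply Lp.norm_le_norm_of_ae_le <;>
    filter_upwards [coeFn_mulOp g hg f] with x hx <;> simp [hx, h]

section Unitary

variable {T : Type*} [MeasurableSpace T] {σ : Measure T} [SigmaFinite σ]
  (K : StatisticsKernel σ)

theorem norm_Psi {n : ℕ} (π : Equiv.Perm (Fin n)) (F : NSpace σ n) : ‖Psi K π F‖ = ‖F‖ :=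
  (norm_mulOp_apply (memLp_phase K π⁻¹) (norm_phase K π⁻¹) _).trans
    (LinearIsometry.norm_map _ _)

theorem inner_Psi_Psi {n : ℕ} (π : Equiv.Perm (Fin n)) (F G : NSpace σ n) :
    inner ℂ (Psi K π F) (Psi K π G) = inner ℂ F G :=
  LinearIsometry.inner_map_map ⟨(Psi K π).toLinearMap, norm_Psi K π⟩ F G

theorem Psi_Psi {n : ℕ} (π ρ : Equiv.Perm (Fin n)) (F : NSpace σ n) :
    Psi K π (Psi K ρ F) = Psi K (π * ρ) F := by
  rw [Psi_mul]; rfl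

theorem inner_Psi_left {n : ℕ} (π : Equiv.Perm (Fin n)) (F G : NSpace σ n) :
    inner ℂ (Psi K π F) G = inner ℂ F (Psi K π⁻¹ G) := by
  rw [← inner_Psi_Psi K π F, Psi_Psi, mul_inv_cancel, Psi_one]
  rfl

theorem symmetrization_apply {n : ℕ} (F : NSpace σ n) :
    symmetrization K n F = (n ! : ℂ)⁻¹ • ∑ π, Psi K π F := by
  simp [symmetrization]

/-- The adjoint of Ψ_π is Ψ_{π⁻¹}, and inversion permutes the symmetric group. Together with
idempotency this makes P_n an orthogonal projection. -/
theorem inner_symmetrization_left {n : ℕ} (F G : NSpace σ n) :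
    inner ℂ (symmetrization K n F) G = inner ℂ F (symmetrization K n G) := by
  simp only [symmetrization_apply, inner_smul_left, inner_smul_right, sum_inner, inner_sum,
    inner_Psi_left, map_inv₀, Complex.conj_natCast]
  congr 1
  exact Equiv.sum_comp (Equiv.inv (Equiv.Perm (Fin n))) fun π => inner ℂ F (Psi K π G)

theorem symmetrization_Psi {n : ℕ} (π : Equiv.Perm (Fin n)) (F : NSpace σ n) :
    symmetrization K n (Psi K π F) = symmetrization K n F := by
  simp only [symmetrization_apply, Psi_Psi]
  congr 1
  exact Equiv.sum_comp (Equiv.mulRight π) fun ρ => Psi K ρ F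

theorem Psi_apply_of_mem {n : ℕ} (π : Equiv.Perm (Fin n)) {F : NSpace σ n}
    (hF : F ∈ QSymm K n) : Psi K π F = F :=
  (mem_QSymm_iff K F).1 hF π

theorem symmetrization_of_mem {n : ℕ} {F : NSpace σ n} (hF : F ∈ QSymm K n) :
    symmetrization K n F = F := by
  obtain ⟨G, rfl⟩ := hF
  exact DFunLike.congr_fun (isIdempotentElem_symmetrization K n) G

theorem symmetrization_mem {n : ℕ} (F : NSpace σ n) : symmetrization K n F ∈ QSymm K n :=
  ⟨F, rfl⟩

theorem inner_symmetrization_left_of_mem {n : ℕ} (F : NSpace σ n) {G : NSpace σ n}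
    (hG : G ∈ QSymm K n) : inner ℂ (symmetrization K n F) G = inner ℂ F G := by
  rw [inner_symmetrization_left, symmetrization_of_mem K hG]

/-! ### Permutations of the tail -/

/-- The permutation of `Fin (n + 1)` which fixes `0` and acts as `e` on the tail. -/
def extPerm {n : ℕ} (e : Equiv.Perm (Fin n)) : Equiv.Perm (Fin (n + 1)) :=
  Equiv.Perm.decomposeFin.symm (0, e)

@[simp] theorem extPerm_zero {n : ℕ} (e : Equiv.Perm (Fin n)) : extPerm e 0 = 0 :=
  Equiv.Perm.decomposeFin_symm_apply_zero 0 e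

@[simp] theorem extPerm_succ {n : ℕ} (e : Equiv.Perm (Fin n)) (i : Fin n) :
    extPerm e i.succ = (e i).succ := by
  simp [extPerm]

theorem extPerm_inv {n : ℕ} (e : Equiv.Perm (Fin n)) : (extPerm e)⁻¹ = extPerm e⁻¹ := by
  rw [inv_eq_iff_mul_eq_one]
  ext i
  refine Fin.cases ?_ (fun i => ?_) i <;> simp

/-- Cosets of the stabilizer of `0`, with the transpositions (0 p) as representatives. -/
theorem decomposeFin_symm_eq {n : ℕ} (p : Fin (n + 1)) (e : Equiv.Perm (Fin n)) :
    Equiv.Perm.decomposeFin.symm (p, e) = Equiv.swap 0 p * extPerm e := by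
  ext i
  refine Fin.cases ?_ (fun i => ?_) i <;> simp

theorem tail_comp_extPerm {n : ℕ} (e : Equiv.Perm (Fin n)) (t : Fin (n + 1) → T) :
    Fin.tail (t ∘ extPerm e) = Fin.tail t ∘ e := by
  funext i
  simp [Fin.tail]

/-- The least index is fixed, so it takes part in no inversion. -/
theorem phase_extPerm {n : ℕ} (e : Equiv.Perm (Fin n)) (t : Fin (n + 1) → T) :
    phase K (extPerm e) t = phase K e (Fin.tail t) := by
  rw [phase_eq_prod, phase_eq_prod]
  simp [Fin.prod_univ_succ, Fin.tail]

theorem quasiMeasurePreserving_head (n : ℕ) :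
    Measure.QuasiMeasurePreserving (fun t : Fin (n + 1) → T => t 0)
      (Measure.pi fun _ : Fin (n + 1) => σ) σ :=
  (Measure.quasiMeasurePreserving_fst (μ := σ) (ν := Measure.pi fun _ : Fin n => σ)).comp
    (measurePreserving_headTail (σ := σ) n).quasiMeasurePreserving

theorem quasiMeasurePreserving_tail (n : ℕ) :
    Measure.QuasiMeasurePreserving (fun t : Fin (n + 1) → T => Fin.tail t)
      (Measure.pi fun _ : Fin (n + 1) => σ) (Measure.pi fun _ : Fin n => σ) :=
  (Measure.quasiMeasurePreserving_snd (μ := σ) (ν := Measure.pi fun _ : Fin n => σ)).comp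
    (measurePreserving_headTail (σ := σ) n).quasiMeasurePreserving

theorem quasiMeasurePreserving_perm {n : ℕ} (π : Equiv.Perm (Fin n)) :
    Measure.QuasiMeasurePreserving (fun t : Fin n → T => t ∘ π)
      (Measure.pi fun _ : Fin n => σ) (Measure.pi fun _ : Fin n => σ) :=
  (measurePreserving_perm π).quasiMeasurePreserving

theorem Psi_extPerm_tensorLeft {n : ℕ} (e : Equiv.Perm (Fin n)) (f : Lp ℂ 2 σ)
    (x : NSpace σ n) :
    Psi K (extPerm e) (tensorLeft n f x) = tensorLeft n f (Psi K e x) := by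
  apply Lp.ext
  filter_upwards [coeFn_Psi K (extPerm e) (tensorLeft n f x),
    (quasiMeasurePreserving_perm (extPerm e)).ae (coeFn_tensorLeft f x),
    coeFn_tensorLeft f (Psi K e x), (quasiMeasurePreserving_tail n).ae (coeFn_Psi K e x)]
    with t h1 h2 h3 h4
  rw [h1, h2, h3, h4, extPerm_inv, phase_extPerm, tail_comp_extPerm]
  simp only [Function.comp_apply, extPerm_zero]
  ring

/-- Symmetrizing the tail is an average of operators Ψ_π with π fixing `0`, each of which is
absorbed by the full symmetrization. -/
theorem symmetrization_tensorLeft_symmetrization {n : ℕ} (f : Lp ℂ 2 σ) (x : NSpace σ n) :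
    symmetrization K (n + 1) (tensorLeft n f (symmetrization K n x)) =
      symmetrization K (n + 1) (tensorLeft n f x) := by
  rw [symmetrization_apply K x]
  simp only [map_smul, map_sum, ← Psi_extPerm_tensorLeft, symmetrization_Psi]
  rw [Finset.sum_const, Finset.card_univ, Fintype.card_perm, Fintype.card_fin,
    ← Nat.cast_smul_eq_nsmul ℂ, smul_smul, inv_mul_cancel₀, one_smul]
  exact_mod_cast Nat.factorial_ne_zero n

theorem Psi_extPerm_of_mem {n : ℕ} (e : Equiv.Perm (Fin n)) (f : Lp ℂ 2 σ) {x : NSpace σ n}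
    (hx : x ∈ QSymm K n) : Psi K (extPerm e) (tensorLeft n f x) = tensorLeft n f x := by
  rw [Psi_extPerm_tensorLeft, Psi_apply_of_mem K e hx]

/-- The decomposition of the symmetrization of a function which is already symmetric in all but
its first variable. -/
theorem inner_symmetrization_of_tail {n : ℕ} {U H : NSpace σ (n + 1)}
    (hH : ∀ e : Equiv.Perm (Fin n), Psi K (extPerm e) H = H) :
    ((n + 1 : ℕ) : ℂ) * inner ℂ U (symmetrization K (n + 1) H) =
      inner ℂ U H + ∑ j : Fin n, inner ℂ U (Psi K (Equiv.swap 0 j.succ) H) := by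
  -- Each coset contributes n! equal terms because the stabilizer of `0` fixes `H`; the coset p = 0
  -- gives `H` itself.
  have h1 : ∑ π, Psi K π H = (n ! : ℂ) • (H + ∑ j : Fin n, Psi K (Equiv.swap 0 j.succ) H) := by
    rw [← Equiv.sum_comp Equiv.Perm.decomposeFin.symm, Fintype.sum_prod_type]
    simp only [decomposeFin_symm_eq, ← Psi_Psi, hH]
    rw [Fin.sum_univ_succ, Equiv.swap_self, ← Equiv.Perm.one_def, Psi_one]
    simp only [Finset.sum_const, Finset.card_univ, Fintype.card_perm, Fintype.card_fin,
      ← Nat.cast_smul_eq_nsmul ℂ, smul_add, Finset.smul_sum]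
    rfl
  rw [symmetrization_apply, h1, smul_smul, inner_smul_right, ← mul_assoc, ← inner_sum,
    ← inner_add_right]
  have h2 : (n ! : ℂ) ≠ 0 := by exact_mod_cast Nat.factorial_ne_zero n
  have h3 : (n + 1 : ℂ) ≠ 0 := by exact_mod_cast Nat.succ_ne_zero n
  rw [Nat.factorial_succ]
  push_cast
  field_simp

/-- The transpositions (0 j) are conjugate to (0 1) under the stabilizer of `0`. That subgroup fixes
both `U` and `H`, so the n + 1 exchange terms are equal. -/
theorem inner_symmetrization_of_tail_succ {n : ℕ} {U H : NSpace σ (n + 2)}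
    (hU : ∀ e : Equiv.Perm (Fin (n + 1)), Psi K (extPerm e) U = U)
    (hH : ∀ e : Equiv.Perm (Fin (n + 1)), Psi K (extPerm e) H = H) :
    ((n + 2 : ℕ) : ℂ) * inner ℂ U (symmetrization K (n + 2) H) =
      inner ℂ U H + ((n + 1 : ℕ) : ℂ) * inner ℂ U (Psi K (Equiv.swap 0 1) H) := by
  rw [inner_symmetrization_of_tail K hH]
  congr 1
  have : ∀ j : Fin (n + 1), inner ℂ U (Psi K (Equiv.swap 0 j.succ) H) =
      inner ℂ U (Psi K (Equiv.swap 0 1) H) := by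
    intro j
    have h1 : Equiv.swap 0 j.succ =
        extPerm (Equiv.swap 0 j) * Equiv.swap 0 1 * (extPerm (Equiv.swap 0 j))⁻¹ := by
      rw [← Equiv.swap_apply_apply, extPerm_zero, ← Fin.succ_zero_eq_one, extPerm_succ,
        Equiv.swap_apply_left]
    rw [h1, ← Psi_Psi, ← Psi_Psi, extPerm_inv, hH, ← inv_inv (extPerm (Equiv.swap 0 j)),
      ← inner_Psi_left, extPerm_inv, hU]
  simp [this]

end Unitary

/-! ### Twisted creation -/

/-- A bounded measurable real-valued function of two variables. -/
structure Twist (T : Type*) [MeasurableSpace T] where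
  /-- the function, regarded as complex-valued -/
  toFun : T → T → ℂ
  measurable : Measurable fun p : T × T => toFun p.1 p.2
  norm_le : ∀ s t, ‖toFun s t‖ ≤ 1
  real : ∀ s t, conj (toFun s t) = toFun s t

section TwistFun

variable {T : Type*} [MeasurableSpace T] (τ : Twist T)

/-- The product `∏ τ (s, tⱼ)` over the tail `t₁, …, tₙ`, where `s` is the first variable. -/
def Twist.prod (n : ℕ) (t : Fin (n + 1) → T) : ℂ := ∏ j : Fin n, τ.toFun (t 0) (t j.succ)

theorem Twist.measurable_prod (n : ℕ) : Measurable (τ.prod n) :=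
  Finset.measurable_prod _ fun j _ =>
    τ.measurable.comp (g := fun p : T × T => τ.toFun p.1 p.2)
      (f := fun t : Fin (n + 1) → T => (t 0, t j.succ))
      ((measurable_pi_apply 0).prodMk (measurable_pi_apply j.succ))

theorem Twist.norm_prod_le (n : ℕ) (t : Fin (n + 1) → T) : ‖τ.prod n t‖ ≤ 1 := by
  rw [Twist.prod, norm_prod]
  exact Finset.prod_le_one (fun _ _ => norm_nonneg _) fun j _ => τ.norm_le _ _

theorem Twist.conj_prod (n : ℕ) (t : Fin (n + 1) → T) : conj (τ.prod n t) = τ.prod n t := by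
  simp [Twist.prod, map_prod, τ.real]

theorem Twist.prod_comp_extPerm {n : ℕ} (e : Equiv.Perm (Fin n)) (t : Fin (n + 1) → T) :
    τ.prod n (t ∘ extPerm e) = τ.prod n t := by
  simp only [Twist.prod, Function.comp_apply, extPerm_zero, extPerm_succ]
  exact Equiv.prod_comp e fun j => τ.toFun (t 0) (t j.succ)

theorem tail_tail_comp_swap {n : ℕ} (t : Fin (n + 2) → T) :
    Fin.tail (Fin.tail (t ∘ Equiv.swap 0 1)) = Fin.tail (Fin.tail t) := by
  funext j
  have h0 : j.succ.succ ≠ 0 := Fin.succ_ne_zero _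
  have h1 : j.succ.succ ≠ 1 := by
    rw [← Fin.succ_zero_eq_one]
    exact fun h => Fin.succ_ne_zero j (Fin.succ_injective _ h)
  simp [Fin.tail, Equiv.swap_apply_of_ne_of_ne h0 h1]

/-- After the exchange, t₁ is the head and t₀ opens the tail. The isolated factor τ(t₁, t₀) is the
one that cancels the phase Q(t₀, t₁) later on. -/
theorem Twist.prod_succ_comp_swap {n : ℕ} (t : Fin (n + 2) → T) :
    τ.prod (n + 1) (t ∘ Equiv.swap 0 1) = τ.toFun (t 1) (t 0) * τ.prod n (Fin.tail t) := by
  rw [Twist.prod, Fin.prod_univ_succ]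
  have h : ∀ j : Fin n, (t ∘ Equiv.swap 0 1) j.succ.succ = t j.succ.succ := fun j =>
    congrFun (tail_tail_comp_swap t) j
  simp only [h]
  simp [Twist.prod, Fin.tail]

end TwistFun

section TwistOp

variable {T : Type*} [MeasurableSpace T] {σ : Measure T} (K : StatisticsKernel σ) (τ : Twist T)

theorem Twist.memLp_prod (n : ℕ) : MemLp (τ.prod n) ∞ (Measure.pi fun _ : Fin (n + 1) => σ) :=
  memLp_top_of_bound (τ.measurable_prod n).aestronglyMeasurable 1
    (Eventually.of_forall (τ.norm_prod_le n))

theorem Twist.memLp_prod_tail (n : ℕ) :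
    MemLp (fun t : Fin (n + 2) → T => τ.prod n (Fin.tail t)) ∞
      (Measure.pi fun _ : Fin (n + 2) => σ) :=
  memLp_top_of_bound ((τ.measurable_prod n).comp
      (measurable_pi_lambda _ fun j => measurable_pi_apply j.succ)).aestronglyMeasurable 1
    (Eventually.of_forall fun t => τ.norm_prod_le n _)

/-- Multiplication by the function `τ.prod n`. -/
def twistOp (n : ℕ) : NSpace σ (n + 1) →L[ℂ] NSpace σ (n + 1) :=
  mulOp (τ.prod n) (τ.memLp_prod n)

/-- Multiplication by the function `τ.prod n` of the tail. -/
def tailTwistOp (n : ℕ) : NSpace σ (n + 2) →L[ℂ] NSpace σ (n + 2) :=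
  mulOp (fun t => τ.prod n (Fin.tail t)) (τ.memLp_prod_tail n)

theorem inner_twistOp {n : ℕ} (F G : NSpace σ (n + 1)) :
    inner ℂ (twistOp τ n F) G = inner ℂ F (twistOp τ n G) :=
  inner_mulOp _ (τ.conj_prod n) F G

theorem inner_tailTwistOp {n : ℕ} (F G : NSpace σ (n + 2)) :
    inner ℂ (tailTwistOp τ n F) G = inner ℂ F (tailTwistOp τ n G) :=
  inner_mulOp _ (fun _ => τ.conj_prod n _) F G

variable [SigmaFinite σ]

theorem Psi_extPerm_twistOp {n : ℕ} (e : Equiv.Perm (Fin n)) (F : NSpace σ (n + 1)) :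
    Psi K (extPerm e) (twistOp τ n F) = twistOp τ n (Psi K (extPerm e) F) := by
  apply Lp.ext
  filter_upwards [coeFn_Psi K (extPerm e) (twistOp τ n F), coeFn_Psi K (extPerm e) F,
    (quasiMeasurePreserving_perm (extPerm e)).ae (coeFn_mulOp _ (τ.memLp_prod n) F),
    coeFn_mulOp _ (τ.memLp_prod n) (Psi K (extPerm e) F)] with t h1 h2 h3 h4
  rw [twistOp] at h1 ⊢
  rw [h1, h3, h4, h2, τ.prod_comp_extPerm]
  ring

theorem tensorLeft_twistOp {n : ℕ} (f : Lp ℂ 2 σ) (F : NSpace σ (n + 1)) :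
    tensorLeft (n + 1) f (twistOp τ n F) = tailTwistOp τ n (tensorLeft (n + 1) f F) := by
  apply Lp.ext
  filter_upwards [coeFn_tensorLeft f (twistOp τ n F), coeFn_tensorLeft f F,
    (quasiMeasurePreserving_tail (n + 1)).ae (coeFn_mulOp _ (τ.memLp_prod n) F),
    coeFn_mulOp _ (τ.memLp_prod_tail n) (tensorLeft (n + 1) f F)] with t h1 h2 h3 h4
  rw [twistOp] at h1 ⊢
  rw [tailTwistOp, h1, h3, h4, h2]
  ring

variable (σ) in
/-- The exchange of the first two variables. -/
def swapOp (n : ℕ) : NSpace σ (n + 2) →L[ℂ] NSpace σ (n + 2) :=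
  (Lp.compMeasurePreservingₗᵢ ℂ (fun t : Fin (n + 2) → T => t ∘ Equiv.swap 0 1)
    (measurePreserving_perm _)).toContinuousLinearMap

theorem coeFn_swapOp {n : ℕ} (F : NSpace σ (n + 2)) :
    swapOp σ n F =ᵐ[Measure.pi fun _ : Fin (n + 2) => σ] fun t => F (t ∘ Equiv.swap 0 1) :=
  Lp.coeFn_compMeasurePreserving F (measurePreserving_perm (σ := σ) (Equiv.swap 0 1))

theorem swapOp_swapOp {n : ℕ} (F : NSpace σ (n + 2)) : swapOp σ n (swapOp σ n F) = F := by
  apply Lp.ext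
  filter_upwards [coeFn_swapOp (swapOp σ n F),
    (quasiMeasurePreserving_perm (Equiv.swap 0 1)).ae (coeFn_swapOp F)] with t h1 h2
  rw [h1, h2]
  congr 1
  funext i
  simp

theorem inner_swapOp {n : ℕ} (F G : NSpace σ (n + 2)) :
    inner ℂ (swapOp σ n F) G = inner ℂ F (swapOp σ n G) := by
  conv_lhs => rw [← swapOp_swapOp G]
  exact LinearIsometry.inner_map_map _ _ _

theorem swapOp_tensorLeft_tensorLeft {n : ℕ} (f g : Lp ℂ 2 σ) (x : NSpace σ n) :
    swapOp σ n (tensorLeft (n + 1) f (tensorLeft n g x)) =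
      tensorLeft (n + 1) g (tensorLeft n f x) := by
  have key : ∀ f g : Lp ℂ 2 σ, tensorLeft (n + 1) f (tensorLeft n g x)
      =ᵐ[Measure.pi fun _ : Fin (n + 2) => σ]
        fun t => f (t 0) * (g (t 1) * x (Fin.tail (Fin.tail t))) := by
    intro f g
    filter_upwards [coeFn_tensorLeft f (tensorLeft n g x),
      (quasiMeasurePreserving_tail (n + 1)).ae (coeFn_tensorLeft g x)] with t h1 h2
    rw [h1, h2]
    rfl
  apply Lp.ext
  filter_upwards [coeFn_swapOp (tensorLeft (n + 1) f (tensorLeft n g x)),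
    (quasiMeasurePreserving_perm (Equiv.swap 0 1)).ae (key f g), key g f] with t h1 h2 h3
  rw [h1, h2, h3, tail_tail_comp_swap]
  simp only [Function.comp_apply, Equiv.swap_apply_left, Equiv.swap_apply_right]
  ring

/-- Contraction of the first variable, the adjoint of tensoring from the left. -/
abbrev contractLeft (n : ℕ) (f : Lp ℂ 2 σ) : NSpace σ (n + 1) →L[ℂ] NSpace σ n :=
  ContinuousLinearMap.adjoint (tensorLeft n f)

theorem contractLeft_tensorLeft {n : ℕ} (f g : Lp ℂ 2 σ) (x : NSpace σ n) :
    contractLeft n f (tensorLeft n g x) = inner ℂ f g • x := by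
  refine ext_inner_left ℂ fun y => ?_
  rw [ContinuousLinearMap.adjoint_inner_right, inner_tensorLeft, inner_smul_right]

/-- The exchange moves `f` to the second place, so contracting the first place acts on `w` alone. By
totality it suffices to take `w` of the form h ⊗ y. -/
theorem contractLeft_swapOp_tensorLeft {n : ℕ} (f g : Lp ℂ 2 σ) (w : NSpace σ (n + 1)) :
    contractLeft (n + 1) g (swapOp σ n (tensorLeft (n + 1) f w)) =
      tensorLeft n f (contractLeft n g w) := by
  refine DFunLike.congr_fun (ext_of_forall_tensorLeft
    (F := (contractLeft (n + 1) g).comp ((swapOp σ n).comp (tensorLeft (n + 1) f)))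
    (G := (tensorLeft n f).comp (contractLeft n g)) fun h y => ?_) w
  simp only [ContinuousLinearMap.comp_apply]
  rw [swapOp_tensorLeft_tensorLeft, contractLeft_tensorLeft, contractLeft_tensorLeft, map_smul]

theorem Psi_contractLeft {n : ℕ} (e : Equiv.Perm (Fin n)) (f : Lp ℂ 2 σ)
    (w : NSpace σ (n + 1)) :
    Psi K e (contractLeft n f w) = contractLeft n f (Psi K (extPerm e) w) := by
  refine ext_inner_left ℂ fun y => ?_
  rw [ContinuousLinearMap.adjoint_inner_right, ← inv_inv (extPerm e), ← inner_Psi_left,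
    extPerm_inv, Psi_extPerm_tensorLeft, ← ContinuousLinearMap.adjoint_inner_right,
    inner_Psi_left, inv_inv]

theorem contractLeft_mem {n : ℕ} (f : Lp ℂ 2 σ) {w : NSpace σ (n + 1)}
    (hw : w ∈ QSymm K (n + 1)) : contractLeft n f w ∈ QSymm K n := by
  rw [mem_QSymm_iff]
  intro e
  rw [Psi_contractLeft, Psi_apply_of_mem K _ hw]

theorem contractLeft_twistOp_mem {n : ℕ} (f : Lp ℂ 2 σ) {w : NSpace σ (n + 1)}
    (hw : w ∈ QSymm K (n + 1)) : contractLeft n f (twistOp τ n w) ∈ QSymm K n := by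
  rw [mem_QSymm_iff]
  intro e
  rw [Psi_contractLeft, Psi_extPerm_twistOp, Psi_apply_of_mem K _ hw]

theorem quasiMeasurePreserving_pair {n : ℕ} :
    Measure.QuasiMeasurePreserving (fun t : Fin (n + 2) → T => (t 0, t 1))
      (Measure.pi fun _ : Fin (n + 2) => σ) (σ.prod σ) :=
  (MeasureTheory.QuasiMeasurePreserving.prodMap (Measure.QuasiMeasurePreserving.id σ)
    (quasiMeasurePreserving_head (σ := σ) n)).comp
    (measurePreserving_headTail (σ := σ) (n + 1)).quasiMeasurePreserving

/-! ### Exchange of the first two variables when the twist inverts the statistics function -/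

section Inverse

variable {K τ} (hτ : ∀ᵐ p ∂σ.prod σ, K.qfun p.1 p.2 * τ.toFun p.2 p.1 = 1)
include hτ

/-- The phase Q(t₀, t₁) meets the factor τ(t₁, t₀) of the exchanged twist and cancels it. What is
left is the plain exchange and the twist over the remaining variables. -/
theorem Psi_swap_twistOp {n : ℕ} (F : NSpace σ (n + 2)) :
    Psi K (Equiv.swap 0 1) (twistOp τ (n + 1) F) = tailTwistOp τ n (swapOp σ n F) := by
  apply Lp.ext
  filter_upwards [Psi_swap K 0 (twistOp τ (n + 1) F),
    (quasiMeasurePreserving_perm (Equiv.swap 0 1)).ae (coeFn_mulOp _ (τ.memLp_prod (n + 1)) F),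
    coeFn_mulOp _ (τ.memLp_prod_tail n) (swapOp σ n F), coeFn_swapOp F,
    (quasiMeasurePreserving_pair (n := n)).ae hτ] with t h1 h2 h3 h4 h5
  simp only [Fin.castSucc_zero, Fin.succ_zero_eq_one] at h1
  rw [tailTwistOp, h1, h3, h4, twistOp, h2, τ.prod_succ_comp_swap, ← mul_assoc, ← mul_assoc, h5,
    one_mul]

/-- Commutation of left and right creation. The inner symmetrizations are absorbed by the outer one,
and both sides become the symmetrization of the tail twist of f ⊗ g ⊗ x, the right-hand side after
inserting Ψ for (0 1). -/
theorem symmetrization_twistOp_comm {n : ℕ} (f g : Lp ℂ 2 σ) (x : NSpace σ n) :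
    symmetrization K (n + 2) (tensorLeft (n + 1) f
        (symmetrization K (n + 1) (twistOp τ n (tensorLeft n g x)))) =
      symmetrization K (n + 2) (twistOp τ (n + 1) (tensorLeft (n + 1) g
        (symmetrization K (n + 1) (tensorLeft n f x)))) := by
  -- The twist is symmetric in the tail variables, so it does not prevent the outer symmetrization
  -- from absorbing the inner one.
  have h : symmetrization K (n + 2) (twistOp τ (n + 1) (tensorLeft (n + 1) g
        (symmetrization K (n + 1) (tensorLeft n f x)))) =
      symmetrization K (n + 2) (twistOp τ (n + 1) (tensorLeft (n + 1) g (tensorLeft n f x))) := by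
    rw [symmetrization_apply K (tensorLeft n f x)]
    simp only [map_smul, map_sum, ← Psi_extPerm_tensorLeft, ← Psi_extPerm_twistOp,
      symmetrization_Psi]
    rw [Finset.sum_const, Finset.card_univ, Fintype.card_perm, Fintype.card_fin,
      ← Nat.cast_smul_eq_nsmul ℂ, smul_smul, inv_mul_cancel₀, one_smul]
    exact_mod_cast Nat.factorial_ne_zero (n + 1)
  rw [h, symmetrization_tensorLeft_symmetrization, tensorLeft_twistOp,
    ← symmetrization_Psi K (Equiv.swap 0 1) (twistOp τ (n + 1) _), Psi_swap_twistOp hτ,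
    swapOp_tensorLeft_tensorLeft]

/-- Without its phase, the exchange makes each one-particle function contract the vector on the
opposite side. An exchange term arising from creation followed by annihilation thus becomes a term
in which annihilation comes first. -/
theorem inner_tensorLeft_Psi_swap_twistOp {n : ℕ} (f g : Lp ℂ 2 σ) (u x : NSpace σ (n + 1)) :
    inner ℂ (tensorLeft (n + 1) f u)
        (Psi K (Equiv.swap 0 1) (twistOp τ (n + 1) (tensorLeft (n + 1) g x))) =
      inner ℂ (contractLeft n g (twistOp τ n u)) (contractLeft n f x) := by
  rw [Psi_swap_twistOp hτ, ← inner_tailTwistOp, ← tensorLeft_twistOp, ← inner_swapOp,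
    ← ContinuousLinearMap.adjoint_inner_left, contractLeft_swapOp_tensorLeft,
    ContinuousLinearMap.adjoint_inner_right]

end Inverse

/-- Both functions sit at the same variable t₀. They and the twist are real, so the two integrands
agree. -/
theorem inner_tensorLeft_twistOp_comm {n : ℕ} {f g : Lp ℂ 2 σ} (hf : ∀ᵐ t ∂σ, conj (f t) = f t)
    (hg : ∀ᵐ t ∂σ, conj (g t) = g t) (u x : NSpace σ n) :
    inner ℂ (tensorLeft n f u) (twistOp τ n (tensorLeft n g x)) =
      inner ℂ (twistOp τ n (tensorLeft n g u)) (tensorLeft n f x) := by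
  rw [inner_twistOp, L2.inner_def, L2.inner_def]
  refine integral_congr_ae ?_
  filter_upwards [coeFn_tensorLeft f u, coeFn_tensorLeft g x, coeFn_tensorLeft g u,
    coeFn_tensorLeft f x, coeFn_mulOp _ (τ.memLp_prod n) (tensorLeft n g x),
    coeFn_mulOp _ (τ.memLp_prod n) (tensorLeft n f x), (quasiMeasurePreserving_head n).ae hf,
    (quasiMeasurePreserving_head n).ae hg] with t h1 h2 h3 h4 h5 h6 h7 h8
  rw [twistOp, h1, h3, h5, h6, h2, h4]
  simp only [RCLike.inner_apply, map_mul, h7, h8]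
  ring

theorem Psi_extPerm_twistOp_of_mem {n : ℕ} (e : Equiv.Perm (Fin n)) (f : Lp ℂ 2 σ)
    {x : NSpace σ n} (hx : x ∈ QSymm K n) :
    Psi K (extPerm e) (twistOp τ n (tensorLeft n f x)) = twistOp τ n (tensorLeft n f x) := by
  rw [Psi_extPerm_twistOp, Psi_extPerm_of_mem K e f hx]

-- The matrix-element form of the mixed commutation relation. Each symmetrization splits into a term
-- without exchange and n + 1 equal exchange terms. The former agree on the two sides by reality;
-- the exchange terms of each side are the contraction terms of the other.
variable {K τ} in
theorem inner_symmetrization_twistOp_comm (hτ : ∀ᵐ p ∂σ.prod σ, K.qfun p.1 p.2 * τ.toFun p.2 p.1 = 1)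
    {n : ℕ} {f g : Lp ℂ 2 σ} (hf : ∀ᵐ t ∂σ, conj (f t) = f t) (hg : ∀ᵐ t ∂σ, conj (g t) = g t)
    {u x : NSpace σ (n + 1)} (hu : u ∈ QSymm K (n + 1)) (hx : x ∈ QSymm K (n + 1)) :
    ((n + 2 : ℕ) : ℂ) * inner ℂ (tensorLeft (n + 1) f u)
        (symmetrization K (n + 2) (twistOp τ (n + 1) (tensorLeft (n + 1) g x))) +
      ((n + 1 : ℕ) : ℂ) *
        inner ℂ (contractLeft n f u) (contractLeft n g (twistOp τ n x)) =
    ((n + 2 : ℕ) : ℂ) * inner ℂ (twistOp τ (n + 1) (tensorLeft (n + 1) g u))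
        (symmetrization K (n + 2) (tensorLeft (n + 1) f x)) +
      ((n + 1 : ℕ) : ℂ) *
        inner ℂ (contractLeft n g (twistOp τ n u)) (contractLeft n f x) := by
  rw [inner_symmetrization_of_tail_succ K (fun e => Psi_extPerm_of_mem K e f hu)
      (fun e => Psi_extPerm_twistOp_of_mem K τ e g hx),
    inner_symmetrization_of_tail_succ K (fun e => Psi_extPerm_twistOp_of_mem K τ e g hu)
      (fun e => Psi_extPerm_of_mem K e f hx),
    inner_tensorLeft_Psi_swap_twistOp hτ, inner_tensorLeft_twistOp_comm τ hf hg]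
  -- The exchange terms of the right-hand side: the same identity with `u` and `x` interchanged,
  -- conjugated; the transposition is its own inverse.
  have h := congrArg conj (inner_tensorLeft_Psi_swap_twistOp hτ f g x u)
  rw [inner_conj_symm, inner_conj_symm, inner_Psi_left, Equiv.swap_inv] at h
  rw [h]
  ring

end TwistOp

/-! ### Raising and lowering operators of the Fock space -/

section Fock

variable {T : Type*} [MeasurableSpace T] {σ : Measure T} [SigmaFinite σ]
  (K : StatisticsKernel σ)

theorem fockFin_ext {F G : FockFin K} (h : ∀ n, F n = G n) : F = G :=
  DFinsupp.ext h

theorem fockInner_lof_left (n : ℕ) (g : QSymm K n) (F : FockFin K) :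
    fockInner K (DirectSum.lof ℂ ℕ (fun n => QSymm K n) n g) F = (n ! : ℂ) * inner ℂ g (F n) := by
  rw [← fockInner_conj, fockInner_lof, map_mul, Complex.conj_natCast]
  exact congrArg _ (inner_conj_symm (𝕜 := ℂ) g (F n))

theorem ext_fockInner_left {F G : FockFin K} (h : ∀ H, fockInner K H F = fockInner K H G) :
    F = G := by
  refine fockFin_ext K fun n => ext_inner_left ℂ fun x => ?_
  have := h (DirectSum.lof ℂ ℕ (fun n => QSymm K n) n x)
  rw [fockInner_lof_left, fockInner_lof_left] at this
  exact mul_left_cancel₀ (by exact_mod_cast Nat.factorial_ne_zero n) this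

variable (B : (n : ℕ) → QSymm K n →L[ℂ] QSymm K (n + 1))

/-- The operator on finite sequences which acts as `B n` on `n`-particle vectors. -/
def raise : Module.End ℂ (FockFin K) :=
  DirectSum.toModule ℂ ℕ _ fun n =>
    (DirectSum.lof ℂ ℕ (fun n => QSymm K n) (n + 1)).comp (B n).toLinearMap

/-- The adjoint of `raise K B` on `n`-particle vectors. -/
def lowerN : (n : ℕ) → QSymm K n →ₗ[ℂ] FockFin K
  | 0 => 0
  | n + 1 => (DirectSum.lof ℂ ℕ (fun n => QSymm K n) n).comp
      (((n + 1 : ℕ) : ℂ) • (ContinuousLinearMap.adjoint (B n)).toLinearMap)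

/-- The adjoint of `raise K B`. -/
def lower : Module.End ℂ (FockFin K) :=
  DirectSum.toModule ℂ ℕ _ (lowerN K B)

theorem creation_eq_raise (h : Lp ℂ 2 σ) : creation K h = raise K (creationN K h) := rfl

theorem annihilation_eq_lower (h : Lp ℂ 2 σ) : annihilation K h = lower K (creationN K h) := by
  rw [annihilation, lower]
  congr 1

theorem raise_apply_zero (F : FockFin K) : raise K B F 0 = 0 := by
  induction F using DirectSum.induction_on with
  | zero => simp
  | of n f =>
    rw [← DirectSum.lof_eq_of ℂ, raise, DirectSum.toModule_lof, LinearMap.comp_apply,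
      DirectSum.lof_eq_of, DirectSum.of_eq_of_ne _ _ _ (by simp)]
  | add F G hF hG => rw [map_add, DirectSum.add_apply, hF, hG, add_zero]

theorem raise_apply_succ (F : FockFin K) (n : ℕ) : raise K B F (n + 1) = B n (F n) := by
  induction F using DirectSum.induction_on with
  | zero => simp
  | of m f =>
    rw [← DirectSum.lof_eq_of ℂ, raise, DirectSum.toModule_lof, LinearMap.comp_apply]
    by_cases hm : m = n
    · subst hm
      rw [DirectSum.lof_apply, DirectSum.lof_apply]
      rfl
    · rw [DirectSum.lof_eq_of, DirectSum.lof_eq_of, DirectSum.of_eq_of_ne _ _ _ (by omega),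
        DirectSum.of_eq_of_ne _ _ _ (by omega), map_zero]
  | add F G hF hG => rw [map_add, DirectSum.add_apply, DirectSum.add_apply, hF, hG, map_add]

theorem lower_apply (F : FockFin K) (n : ℕ) :
    lower K B F n = ((n + 1 : ℕ) : ℂ) • ContinuousLinearMap.adjoint (B n) (F (n + 1)) := by
  induction F using DirectSum.induction_on with
  | zero => simp
  | of m f =>
    rw [← DirectSum.lof_eq_of ℂ, lower, DirectSum.toModule_lof]
    cases m with
    | zero =>
      rw [lowerN, LinearMap.zero_apply, DirectSum.lof_eq_of,
        DirectSum.of_eq_of_ne _ _ _ (by omega), map_zero, smul_zero]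
      rfl
    | succ m =>
      rw [lowerN, LinearMap.comp_apply]
      by_cases hm : m = n
      · subst hm
        rw [DirectSum.lof_apply, DirectSum.lof_apply]
        rfl
      · rw [DirectSum.lof_eq_of, DirectSum.lof_eq_of, DirectSum.of_eq_of_ne _ _ _ (by omega),
          DirectSum.of_eq_of_ne _ _ _ (by omega), map_zero, smul_zero]
  | add F G hF hG =>
    rw [map_add, DirectSum.add_apply, DirectSum.add_apply, hF, hG, map_add]
    exact (smul_add _ _ _).symm

theorem inner_lower_apply (F : FockFin K) (n : ℕ) (u : QSymm K n) :
    inner ℂ u (lower K B F n) = ((n + 1 : ℕ) : ℂ) * inner ℂ (B n u) (F (n + 1)) := by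
  rw [lower_apply, ← ContinuousLinearMap.adjoint_inner_right]
  exact inner_smul_right (𝕜 := ℂ) (E := QSymm K n) _ _ _

theorem fockInner_raise (F G : FockFin K) :
    fockInner K (raise K B F) G = fockInner K F (lower K B G) := by
  induction F using DirectSum.induction_on with
  | zero =>
    have h : ∀ G, fockInner K 0 G = 0 := fun G => by
      simpa using fockInner_add_left K 0 0 G
    rw [map_zero, h, h]
  | of n f =>
    rw [← DirectSum.lof_eq_of ℂ, raise, DirectSum.toModule_lof, LinearMap.comp_apply,
      fockInner_lof_left, fockInner_lof_left, inner_lower_apply, Nat.factorial_succ]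
    push_cast
    rw [mul_comm (n + 1 : ℂ), mul_assoc]
  | add F F' hF hF' => rw [map_add, fockInner_add_left, fockInner_add_left, hF, hF']

theorem fockInner_lower (F G : FockFin K) :
    fockInner K (lower K B F) G = fockInner K F (raise K B G) := by
  rw [← fockInner_conj, ← fockInner_raise, fockInner_conj]

-- Passing to adjoints, which are unique because the inner product is nondegenerate. Relations
-- between lowering operators follow in this way from those between raising operators.
variable {K} in
theorem eq_of_fockInner_eq {p p' q q' : Module.End ℂ (FockFin K)}
    (hp : ∀ F G, fockInner K (p F) G = fockInner K F (p' G))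
    (hq : ∀ F G, fockInner K (q F) G = fockInner K F (q' G)) (h : p = q) : p' = q' :=
  LinearMap.ext fun G => ext_fockInner_left K fun H => by rw [← hp, ← hq, h]

theorem lower_vacuum : lower K B (vacuum K) = 0 := by
  rw [lower, vacuum, DirectSum.toModule_lof]
  rfl

/-! ### Left and right creation -/

/-- Contraction keeps a `Q`-symmetric vector `Q`-symmetric, so the projection in the definition of
creation leaves no trace in the adjoint. -/
theorem adjoint_creationN {n : ℕ} (f : Lp ℂ 2 σ) (w : QSymm K (n + 1)) :
    ((ContinuousLinearMap.adjoint (creationN K f n) w : QSymm K n) : NSpace σ n) =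
      contractLeft n f w := by
  have h : ContinuousLinearMap.adjoint (creationN K f n) w =
      ⟨contractLeft n f w, contractLeft_mem K f w.2⟩ := by
    refine ext_inner_left ℂ fun x => ?_
    rw [ContinuousLinearMap.adjoint_inner_right, Submodule.coe_inner, Submodule.coe_inner,
      ContinuousLinearMap.adjoint_inner_right]
    exact inner_symmetrization_left_of_mem K _ w.2
  rw [h]

variable (τ : Twist T)

/-- Creation from the right on `n`-particle vectors, expressed by a twisted creation from the
left. -/
def rightCreationN (g : Lp ℂ 2 σ) (n : ℕ) : QSymm K n →L[ℂ] QSymm K (n + 1) :=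
  (toQSymm K (n + 1)).comp ((twistOp τ n).comp ((tensorLeft n g).comp (QSymm K n).subtypeL))

theorem coe_creationN (f : Lp ℂ 2 σ) {n : ℕ} (x : QSymm K n) :
    (creationN K f n x : NSpace σ (n + 1)) = symmetrization K (n + 1) (tensorLeft n f x) := rfl

theorem coe_rightCreationN (g : Lp ℂ 2 σ) {n : ℕ} (x : QSymm K n) :
    (rightCreationN K τ g n x : NSpace σ (n + 1)) =
      symmetrization K (n + 1) (twistOp τ n (tensorLeft n g x)) := rfl

theorem adjoint_rightCreationN {n : ℕ} (g : Lp ℂ 2 σ) (w : QSymm K (n + 1)) :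
    ((ContinuousLinearMap.adjoint (rightCreationN K τ g n) w : QSymm K n) : NSpace σ n) =
      contractLeft n g (twistOp τ n w) := by
  have h : ContinuousLinearMap.adjoint (rightCreationN K τ g n) w =
      ⟨contractLeft n g (twistOp τ n w), contractLeft_twistOp_mem K τ g w.2⟩ := by
    refine ext_inner_left ℂ fun x => ?_
    rw [ContinuousLinearMap.adjoint_inner_right, Submodule.coe_inner, Submodule.coe_inner,
      ContinuousLinearMap.adjoint_inner_right, ← inner_twistOp]
    exact inner_symmetrization_left_of_mem K _ w.2
  rw [h]

/-! ### Commutation of left and right creation and annihilation -/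

section Commutation

variable {K τ} (hτ : ∀ᵐ p ∂σ.prod σ, K.qfun p.1 p.2 * τ.toFun p.2 p.1 = 1)
include hτ

theorem raise_mul_raise_comm (f g : Lp ℂ 2 σ) :
    raise K (creationN K f) * raise K (rightCreationN K τ g) =
      raise K (rightCreationN K τ g) * raise K (creationN K f) := by
  refine LinearMap.ext fun F => fockFin_ext K fun n => ?_
  simp only [Module.End.mul_apply]
  match n with
  | 0 => simp only [raise_apply_zero]
  | 1 => simp only [raise_apply_zero, raise_apply_succ, map_zero]
  | n + 2 =>
    simp only [raise_apply_succ]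
    apply Subtype.ext
    simp only [coe_creationN, coe_rightCreationN]
    exact symmetrization_twistOp_comm hτ f g _

theorem lower_mul_lower_comm (f g : Lp ℂ 2 σ) :
    lower K (creationN K f) * lower K (rightCreationN K τ g) =
      lower K (rightCreationN K τ g) * lower K (creationN K f) := by
  refine eq_of_fockInner_eq (fun F G => ?_) (fun F G => ?_) (raise_mul_raise_comm hτ f g).symm <;>
    simp only [Module.End.mul_apply, fockInner_raise]

/-- Left creation need not commute with right annihilation, nor left annihilation with right
creation; it is the sum of the two commutators that vanishes. -/
theorem raise_lower_comm {f g : Lp ℂ 2 σ} (hf : ∀ᵐ t ∂σ, conj (f t) = f t)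
    (hg : ∀ᵐ t ∂σ, conj (g t) = g t) :
    raise K (creationN K f) * lower K (rightCreationN K τ g) +
        lower K (creationN K f) * raise K (rightCreationN K τ g) =
      raise K (rightCreationN K τ g) * lower K (creationN K f) +
        lower K (rightCreationN K τ g) * raise K (creationN K f) := by
  refine LinearMap.ext fun F => fockFin_ext K fun n => ext_inner_left ℂ fun u => ?_
  simp only [LinearMap.add_apply, Module.End.mul_apply, DirectSum.add_apply]
  rw [inner_add_right, inner_add_right, inner_lower_apply, inner_lower_apply]
  -- In degree zero the terms beginning with annihilation contribute nothing and the symmetrization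
  -- is over one variable. In higher degree all four terms are present.
  cases n with
  | zero =>
    simp only [raise_apply_zero, raise_apply_succ, inner_zero_right, zero_add, Nat.cast_one,
      one_mul]
    rw [Submodule.coe_inner, Submodule.coe_inner]
    simp only [coe_creationN, coe_rightCreationN]
    rw [inner_symmetrization_left_of_mem K _ (symmetrization_mem K _),
      inner_symmetrization_left_of_mem K _ (symmetrization_mem K _)]
    have h1 := inner_symmetrization_of_tail K (U := tensorLeft 0 f u)
      (H := twistOp τ 0 (tensorLeft 0 g (F 0)))
      (fun e => Psi_extPerm_twistOp_of_mem K τ e g (F 0).2)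
    have h2 := inner_symmetrization_of_tail K (U := twistOp τ 0 (tensorLeft 0 g u))
      (H := tensorLeft 0 f (F 0)) (fun e => Psi_extPerm_of_mem K e f (F 0).2)
    simp only [zero_add, Nat.cast_one, one_mul, Finset.univ_eq_empty, Finset.sum_empty,
      add_zero] at h1 h2
    rw [h1, h2]
    exact inner_tensorLeft_twistOp_comm τ hf hg _ _
  | succ n =>
    simp only [raise_apply_succ]
    rw [← ContinuousLinearMap.adjoint_inner_left (creationN K f n),
      ← ContinuousLinearMap.adjoint_inner_left (rightCreationN K τ g n), inner_lower_apply,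
      inner_lower_apply, ← ContinuousLinearMap.adjoint_inner_right (rightCreationN K τ g n),
      ← ContinuousLinearMap.adjoint_inner_right (creationN K f n)]
    simp only [Submodule.coe_inner, adjoint_creationN, adjoint_rightCreationN, coe_creationN,
      coe_rightCreationN]
    rw [inner_symmetrization_left_of_mem K _ (symmetrization_mem K _),
      inner_symmetrization_left_of_mem K _ (symmetrization_mem K _), add_comm,
      add_comm (_ * inner ℂ (contractLeft n g _) _)]
    exact inner_symmetrization_twistOp_comm hτ hf hg u.2 (F (n + 1)).2

end Commutation

theorem twistOp_eq_one {n : ℕ} (h : ∀ t, τ.prod n t = 1) :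
    twistOp τ n = (1 : NSpace σ (n + 1) →L[ℂ] NSpace σ (n + 1)) := by
  refine ContinuousLinearMap.ext fun F => Lp.ext ?_
  filter_upwards [coeFn_mulOp _ (τ.memLp_prod n) F] with t ht
  rw [twistOp, ht, h, one_mul]
  rfl

theorem rightCreationN_eq_creationN {n : ℕ} (h : ∀ t, τ.prod n t = 1) (g : Lp ℂ 2 σ) :
    rightCreationN K τ g n = creationN K g n := by
  rw [rightCreationN, twistOp_eq_one τ h]
  rfl

/-- With no particles present the twist is an empty product. -/
theorem raise_rightCreationN_vacuum (g : Lp ℂ 2 σ) :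
    raise K (rightCreationN K τ g) (vacuum K) = raise K (creationN K g) (vacuum K) := by
  rw [raise, raise, vacuum, DirectSum.toModule_lof, DirectSum.toModule_lof,
    rightCreationN_eq_creationN K τ fun t => by simp [Twist.prod]]

/-! ### The neutral operator -/

section Neutral

variable {h : T → ℂ} (hh : Measurable h) {C : ℝ} (hC : ∀ t, ‖h t‖ ≤ C)

variable (σ) in
theorem memLp_top_of_norm_le {h : T → ℂ} (hh : Measurable h) {C : ℝ} (hC : ∀ t, ‖h t‖ ≤ C) :
    MemLp h ∞ σ :=
  memLp_top_of_bound hh.aestronglyMeasurable C (Eventually.of_forall hC)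

theorem mulOp_sum_Psi {n : ℕ} (π : Equiv.Perm (Fin n)) (F : NSpace σ n) :
    mulOp _ (memLp_sum hh hC n) (Psi K π F) = Psi K π (mulOp _ (memLp_sum hh hC n) F) := by
  apply Lp.ext
  have hm := coeFn_mulOp _ (memLp_sum (σ := σ) hh hC n) F
  filter_upwards [coeFn_Psi K π (mulOp _ (memLp_sum hh hC n) F), coeFn_Psi K π F,
    coeFn_mulOp _ (memLp_sum hh hC n) (Psi K π F),
    (quasiMeasurePreserving_perm π).ae hm] with t h1 h2 h3 h4
  rw [h3, h1, h2, h4]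
  have : ∑ i, h ((t ∘ π) i) = ∑ i, h (t i) := Equiv.sum_comp π fun i => h (t i)
  rw [this]
  ring

theorem mulOp_sum_symmetrization {n : ℕ} (F : NSpace σ n) :
    mulOp _ (memLp_sum hh hC n) (symmetrization K n F) =
      symmetrization K n (mulOp _ (memLp_sum hh hC n) F) := by
  simp only [symmetrization_apply, map_smul, map_sum, mulOp_sum_Psi K hh hC]

theorem mulOp_sum_tensorLeft {n : ℕ} (g : Lp ℂ 2 σ) (F : NSpace σ n) :
    mulOp _ (memLp_sum hh hC (n + 1)) (tensorLeft n g F) =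
      tensorLeft n (mulOp h (memLp_top_of_norm_le σ hh hC) g) F +
        tensorLeft n g (mulOp _ (memLp_sum hh hC n) F) := by
  apply Lp.ext
  filter_upwards [coeFn_mulOp _ (memLp_sum hh hC (n + 1)) (tensorLeft n g F),
    coeFn_tensorLeft g F, coeFn_tensorLeft (mulOp h (memLp_top_of_norm_le σ hh hC) g) F,
    coeFn_tensorLeft g (mulOp _ (memLp_sum hh hC n) F),
    Lp.coeFn_add (tensorLeft n (mulOp h (memLp_top_of_norm_le σ hh hC) g) F)
      (tensorLeft n g (mulOp _ (memLp_sum hh hC n) F)),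
    (quasiMeasurePreserving_head n).ae (coeFn_mulOp h (memLp_top_of_norm_le σ hh hC) g),
    (quasiMeasurePreserving_tail n).ae (coeFn_mulOp _ (memLp_sum hh hC n) F)]
    with t h1 h2 h3 h4 h5 h6 h7
  rw [h1, h2, h5, Pi.add_apply, h3, h4, h6, h7, Fin.sum_univ_succ]
  simp only [Fin.tail]
  ring

/-- The multiplier is symmetric, so it commutes with symmetrization; its summand at the head turns
`g` into h g and the others act on the tail. The neutral operator is thus a derivation. -/
theorem neutral_mul_creation (g : Lp ℂ 2 σ) :
    neutral K hh hC * creation K g =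
      creation K (mulOp h (memLp_top_of_norm_le σ hh hC) g) +
        creation K g * neutral K hh hC := by
  refine LinearMap.ext fun F => fockFin_ext K fun n => ?_
  simp only [LinearMap.add_apply, Module.End.mul_apply, DirectSum.add_apply, neutral_apply]
  cases n with
  | zero => simp only [creation_apply_zero, map_zero, add_zero]
  | succ n =>
    simp only [creation_apply_succ, neutral_apply]
    apply Subtype.ext
    have h1 := mulOp_sum_symmetrization K hh hC (tensorLeft n g (F n))
    rw [mulOp_sum_tensorLeft hh hC, map_add] at h1
    exact h1

theorem neutral_vacuum : neutral K hh hC (vacuum K) = 0 := by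
  rw [neutral, vacuum, DirectSum.toModule_lof, LinearMap.comp_apply]
  have h1 : neutralN K hh hC 0 ⟨vacuumFun σ, mem_QSymm_zero K _⟩ = 0 := by
    apply Subtype.ext
    apply Lp.ext
    filter_upwards [coeFn_mulOp _ (memLp_sum hh hC 0) (vacuumFun σ), Lp.coeFn_zero ℂ 2
      (Measure.pi fun _ : Fin 0 => σ)] with t h1 h2
    refine h1.trans ?_
    refine Eq.trans ?_ h2.symm
    simp
  rw [h1, map_zero]

theorem neutral_mul_neutral_comm {h' : T → ℂ} (hh' : Measurable h') {C' : ℝ}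
    (hC' : ∀ t, ‖h' t‖ ≤ C') :
    neutral K hh hC * neutral K hh' hC' = neutral K hh' hC' * neutral K hh hC := by
  refine LinearMap.ext fun F => fockFin_ext K fun n => Subtype.ext <| Lp.ext ?_
  simp only [Module.End.mul_apply, neutral_apply]
  have key : ∀ {h h' : T → ℂ} (hh : Measurable h) {C : ℝ} (hC : ∀ t, ‖h t‖ ≤ C)
      (hh' : Measurable h') {C' : ℝ} (hC' : ∀ t, ‖h' t‖ ≤ C') (w : NSpace σ n),
      mulOp _ (memLp_sum hh hC n) (mulOp _ (memLp_sum hh' hC' n) w)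
      =ᵐ[Measure.pi fun _ : Fin n => σ] fun t => (∑ i, h (t i)) * ((∑ i, h' (t i)) * w t) := by
    intro h h' hh C hC hh' C' hC' w
    filter_upwards [coeFn_mulOp _ (memLp_sum hh hC n) (mulOp _ (memLp_sum hh' hC' n) w),
      coeFn_mulOp _ (memLp_sum hh' hC' n) w] with t h1 h2
    rw [h1, h2]
  filter_upwards [key hh hC hh' hC' (F n), key hh' hC' hh hC (F n)] with t h1 h2
  refine h1.trans (Eq.trans ?_ h2.symm)
  ring

end Neutral

end Fock

/-! ### Fields acting from the right, and traciality -/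

/-- The products are sorted by the change of particle number. The relations `h4` and `h5` carry the
factor `c`, which makes them vacuous when `c` is zero. -/
theorem add_smul_add_mul_comm {A : Type*} [Semiring A] [Algebra ℂ A] (c : ℂ)
    {a n b a' n' b' : A} (h1 : a * a' = a' * a) (h2 : b * b' = b' * b)
    (h3 : a * b' + b * a' = a' * b + b' * a)
    (h4 : c • (n * a' + a * n') = c • (n' * a + a' * n))
    (h5 : c • (b' * n + n' * b) = c • (b * n' + n * b')) (h6 : n * n' = n' * n) :
    (a + c • n + b) * (a' + c • n' + b') = (a' + c • n' + b') * (a + c • n + b) := by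
  calc (a + c • n + b) * (a' + c • n' + b')
      = a * a' + b * b' + (a * b' + b * a') + c • (n * a' + a * n') +
          c • (b * n' + n * b') + c • c • (n * n') := by
        simp only [mul_add, add_mul, smul_mul_assoc, mul_smul_comm, smul_add]
        abel
    _ = a' * a + b' * b + (a' * b + b' * a) + c • (n' * a + a' * n) +
          c • (b' * n + n' * b) + c • c • (n' * n) := by rw [h1, h2, h3, h4, h5, h6]
    _ = _ := by
        simp only [mul_add, add_mul, smul_mul_assoc, mul_smul_comm, smul_add]
        abel

section RightField

variable {T : Type*} [TopologicalSpace T] [MeasurableSpace T]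

/-- A test function as an element of `L²(σ)`. -/
abbrev TestFunction.toL2 (f : TestFunction T) (σ : Measure T) [IsFiniteMeasureOnCompacts σ] :
    Lp ℂ 2 σ :=
  (f.memLp σ).toLp f.toComplex

theorem TestFunction.conj_toL2 (f : TestFunction T) (σ : Measure T)
    [IsFiniteMeasureOnCompacts σ] : ∀ᵐ t ∂σ, conj (f.toL2 σ t) = f.toL2 σ t := by
  filter_upwards [(f.memLp σ).coeFn_toLp] with t ht
  rw [ht]
  exact Complex.conj_ofReal _

variable {σ : Measure T} [SigmaFinite σ] [IsFiniteMeasureOnCompacts σ] (K : StatisticsKernel σ)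

theorem mulOp_toL2_comm (f g : TestFunction T) :
    mulOp f.toComplex (memLp_top_of_norm_le σ f.measurable_toComplex f.norm_toComplex_le)
        (g.toL2 σ) =
      mulOp g.toComplex (memLp_top_of_norm_le σ g.measurable_toComplex g.norm_toComplex_le)
        (f.toL2 σ) := by
  apply Lp.ext
  filter_upwards [coeFn_mulOp f.toComplex
    (memLp_top_of_norm_le σ f.measurable_toComplex f.norm_toComplex_le) (g.toL2 σ),
    coeFn_mulOp g.toComplex
    (memLp_top_of_norm_le σ g.measurable_toComplex g.norm_toComplex_le) (f.toL2 σ),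
    (f.memLp σ).coeFn_toLp, (g.memLp σ).coeFn_toLp] with t h1 h2 h3 h4
  rw [h1, h2, h3, h4, mul_comm]

/-- The neutral operator of a test function. -/
abbrev neutralOp (f : TestFunction T) : Module.End ℂ (FockFin K) :=
  neutral K f.measurable_toComplex f.norm_toComplex_le

theorem field_eq (lam : ℝ) (f : TestFunction T) :
    field K lam f = raise K (creationN K (f.toL2 σ)) + (lam : ℂ) • neutralOp K f +
      lower K (creationN K (f.toL2 σ)) := by
  rw [field, creation_eq_raise, annihilation_eq_lower]

theorem fockInner_neutralOp (f : TestFunction T) (F G : FockFin K) :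
    fockInner K (neutralOp K f F) G = fockInner K F (neutralOp K f G) :=
  fockInner_neutral K f.measurable_toComplex f.norm_toComplex_le
    (fun _ => Complex.conj_ofReal _) F G

/-- Moving the neutral operators to the right of the creation operators leaves a⁺(fg) on both sides.
-/
theorem neutralOp_raise_comm (f g : TestFunction T) :
    neutralOp K f * raise K (creationN K (g.toL2 σ)) +
        raise K (creationN K (f.toL2 σ)) * neutralOp K g =
      neutralOp K g * raise K (creationN K (f.toL2 σ)) +
        raise K (creationN K (g.toL2 σ)) * neutralOp K f := by
  have h1 := neutral_mul_creation K f.measurable_toComplex f.norm_toComplex_le (g.toL2 σ)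
  have h2 := neutral_mul_creation K g.measurable_toComplex g.norm_toComplex_le (f.toL2 σ)
  rw [creation_eq_raise, creation_eq_raise] at h1 h2
  rw [neutralOp, neutralOp, h1, h2, mulOp_toL2_comm]
  abel

theorem neutralOp_lower_comm (f g : TestFunction T) :
    lower K (creationN K (g.toL2 σ)) * neutralOp K f +
        neutralOp K g * lower K (creationN K (f.toL2 σ)) =
      lower K (creationN K (f.toL2 σ)) * neutralOp K g +
        neutralOp K f * lower K (creationN K (g.toL2 σ)) := by
  refine eq_of_fockInner_eq (fun F G => ?_) (fun F G => ?_) (neutralOp_raise_comm K f g) <;>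
    simp only [LinearMap.add_apply, Module.End.mul_apply, fockInner_add_left, map_add,
      fockInner_raise, fockInner_neutralOp]

variable (τ : Twist T)

/-- The field operator acting from the right. -/
def rightField (lam : ℝ) (g : TestFunction T) : Module.End ℂ (FockFin K) :=
  raise K (rightCreationN K τ (g.toL2 σ)) + (lam : ℂ) • neutralOp K g +
    lower K (rightCreationN K τ (g.toL2 σ))

theorem fockInner_smul_left (c : ℂ) (F G : FockFin K) :
    fockInner K (c • F) G = conj c * fockInner K F G := by
  rw [← fockInner_conj, map_smul, smul_eq_mul, map_mul, fockInner_conj]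

theorem fockInner_rightField (lam : ℝ) (g : TestFunction T) (F G : FockFin K) :
    fockInner K (rightField K τ lam g F) G = fockInner K F (rightField K τ lam g G) := by
  simp only [rightField, LinearMap.add_apply, LinearMap.smul_apply, fockInner_add_left, map_add,
    fockInner_raise, fockInner_lower, fockInner_neutralOp, fockInner_smul_left, map_smul,
    smul_eq_mul, Complex.conj_ofReal]
  ring

theorem field_vacuum (lam : ℝ) (f : TestFunction T) :
    field K lam f (vacuum K) = raise K (creationN K (f.toL2 σ)) (vacuum K) := by
  rw [field_eq]
  simp only [LinearMap.add_apply, LinearMap.smul_apply]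
  rw [neutral_vacuum, lower_vacuum, smul_zero, add_zero, add_zero]

theorem rightField_vacuum (lam : ℝ) (f : TestFunction T) :
    rightField K τ lam f (vacuum K) = field K lam f (vacuum K) := by
  rw [field_vacuum, rightField]
  simp only [LinearMap.add_apply, LinearMap.smul_apply]
  rw [neutral_vacuum, lower_vacuum, smul_zero, add_zero, add_zero, raise_rightCreationN_vacuum]

variable {K τ}

/-- For λ = 0 the relations involving neutral operators are void. For a trivial twist, right
creation is left creation and the neutral relations are symmetric in `f` and `g`. -/
theorem field_mul_rightField (lam : ℝ)
    (hτ : ∀ᵐ p ∂σ.prod σ, K.qfun p.1 p.2 * τ.toFun p.2 p.1 = 1)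
    (hlam : lam = 0 ∨ ∀ n t, τ.prod n t = 1) (f g : TestFunction T) :
    field K lam f * rightField K τ lam g = rightField K τ lam g * field K lam f := by
  rw [field_eq, rightField]
  refine add_smul_add_mul_comm _ (raise_mul_raise_comm hτ _ _) (lower_mul_lower_comm hτ _ _)
    (raise_lower_comm hτ (f.conj_toL2 σ) (g.conj_toL2 σ)) ?_ ?_
    (neutral_mul_neutral_comm K _ _ _ _)
  · rcases hlam with rfl | h
    · rw [Complex.ofReal_zero, zero_smul, zero_smul]
    · rw [show rightCreationN K τ (g.toL2 σ) = creationN K (g.toL2 σ) from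
        funext fun n => rightCreationN_eq_creationN K τ (h n) _, neutralOp_raise_comm]
  · rcases hlam with rfl | h
    · rw [Complex.ofReal_zero, zero_smul, zero_smul]
    · rw [show rightCreationN K τ (g.toL2 σ) = creationN K (g.toL2 σ) from
        funext fun n => rightCreationN_eq_creationN K τ (h n) _, neutralOp_lower_comm]

/-- If the fields have Hermitian counterparts which act in the same way on the vacuum and commute
with the fields, then the vacuum state is tracial. -/
theorem vacuumState_mul_comm {lam : ℝ} (Y : TestFunction T → Module.End ℂ (FockFin K))
    (hsymm : ∀ g F G, fockInner K (Y g F) G = fockInner K F (Y g G))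
    (hvac : ∀ g, Y g (vacuum K) = field K lam g (vacuum K))
    (hcomm : ∀ f g, field K lam f * Y g = Y g * field K lam f)
    {p q : Module.End ℂ (FockFin K)} (hp : p ∈ polyAlgebra K lam) (hq : q ∈ polyAlgebra K lam) :
    vacuumState K (p * q) = vacuumState K (q * p) := by
  have hY : ∀ g, ∀ p ∈ polyAlgebra K lam, p * Y g = Y g * p := by
    intro g p hp
    induction hp using Algebra.adjoin_induction with
    | mem x hx =>
      obtain ⟨f, rfl⟩ := hx
      exact hcomm f g
    | algebraMap r => exact Algebra.commutes r _
    | add x y _ _ hx hy => rw [add_mul, mul_add, hx, hy]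
    | mul x y _ _ hx hy => rw [mul_assoc, hy, ← mul_assoc, hx, mul_assoc]
  induction hq using Algebra.adjoin_induction generalizing p with
  | mem x hx =>
    obtain ⟨g, rfl⟩ := hx
    have h1 : p (Y g (vacuum K)) = Y g (p (vacuum K)) := LinearMap.congr_fun (hY g p hp) _
    simp only [vacuumState, Module.End.mul_apply]
    -- The field next to the vacuum is replaced by its partner, moved past `p`, transferred to the
    -- other vacuum by Hermiticity and turned back into the field.
    rw [← hvac, h1, ← hsymm, hvac, fockInner_field]
  | algebraMap r => rw [Algebra.commutes]
  | add x y _ _ hx hy =>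
    have h : ∀ p q : Module.End ℂ (FockFin K),
        vacuumState K (p + q) = vacuumState K p + vacuumState K q := fun p q => by
      simp [vacuumState]
    rw [mul_add, add_mul, h, h, hx hp, hy hp]
  | mul x y hxm hym hx hy =>
    -- Two rotations of the word: p x y to y p x, then to x y p.
    rw [← mul_assoc, hy (mul_mem hp hxm), ← mul_assoc, hx (mul_mem hym hp), mul_assoc]

end RightField

/-! ### Mixed moments of the indicator functions of two disjoint sets -/

section Degree

variable {T : Type*} [MeasurableSpace T] {σ : Measure T} [SigmaFinite σ]
  (K : StatisticsKernel σ)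

/-- The vectors whose only component is the `n`-particle component. -/
def IsDegree (n : ℕ) (F : FockFin K) : Prop := ∀ m, m ≠ n → F m = 0

variable {K}

theorem IsDegree.eq_lof {n : ℕ} {F : FockFin K} (hF : IsDegree K n F) :
    F = DirectSum.lof ℂ ℕ (fun n => QSymm K n) n (F n) := by
  refine fockFin_ext K fun m => ?_
  by_cases h : m = n
  · subst h
    rw [DirectSum.lof_apply]
  · rw [hF m h, DirectSum.lof_eq_of, DirectSum.of_eq_of_ne _ _ _ h]

theorem IsDegree.fockInner_eq {n : ℕ} {F : FockFin K} (hF : IsDegree K n F) (G : FockFin K) :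
    fockInner K F G = (n ! : ℂ) * inner ℂ (F n) (G n) := by
  conv_lhs => rw [hF.eq_lof]
  rw [fockInner_lof_left]

theorem IsDegree.fockInner_eq_zero {m n : ℕ} {F G : FockFin K} (hF : IsDegree K m F)
    (hG : IsDegree K n G) (h : m ≠ n) : fockInner K F G = 0 := by
  rw [hF.fockInner_eq, hG m h, inner_zero_right, mul_zero]

theorem isDegree_vacuum : IsDegree K 0 (vacuum K) := fun m hm => by
  rw [vacuum, DirectSum.lof_eq_of, DirectSum.of_eq_of_ne _ _ _ hm]

theorem vacuum_apply_zero : ((vacuum K 0 : QSymm K 0) : NSpace σ 0) = vacuumFun σ := by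
  rw [vacuum, DirectSum.lof_apply]

variable {B : (n : ℕ) → QSymm K n →L[ℂ] QSymm K (n + 1)}

theorem IsDegree.raise {n : ℕ} {F : FockFin K} (hF : IsDegree K n F) :
    IsDegree K (n + 1) (raise K B F) := fun m hm => by
  cases m with
  | zero => rw [raise_apply_zero]
  | succ m => rw [raise_apply_succ, hF m (by omega), map_zero]

theorem IsDegree.fockInner_raise_self {n : ℕ} {F : FockFin K} (hF : IsDegree K n F) :
    fockInner K F (QFock.raise K B F) = 0 :=
  hF.fockInner_eq_zero hF.raise (by omega)

theorem IsDegree.fockInner_lower_eq_zero {m n : ℕ} {F G : FockFin K} (hF : IsDegree K m F)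
    (hG : IsDegree K n G) (h : m + 1 ≠ n) : fockInner K F (lower K B G) = 0 := by
  rw [← fockInner_raise]
  exact hF.raise.fockInner_eq_zero hG h

variable (K)

theorem lower_raise_vacuum (f g : Lp ℂ 2 σ) :
    lower K (creationN K f) (raise K (creationN K g) (vacuum K)) = inner ℂ f g • vacuum K := by
  refine ext_fockInner_left K fun H => ?_
  rw [← fockInner_raise, map_smul, ← fockInner_conj, ← fockInner_conj K (vacuum K),
    isDegree_vacuum.raise.fockInner_eq, isDegree_vacuum.fockInner_eq, raise_apply_succ,
    raise_apply_succ, Submodule.coe_inner, Submodule.coe_inner, coe_creationN, coe_creationN]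
  have h : ∀ F : NSpace σ 1, symmetrization K 1 F = F := fun F => by
    refine symmetrization_of_mem K ((mem_QSymm_iff K F).2 fun π => ?_)
    rw [Subsingleton.elim π 1, Psi_one]
    rfl
  rw [h, h, inner_tensorLeft]
  simp only [map_mul, inner_conj_symm, smul_eq_mul]
  simp

theorem raise_creationN_zero : raise K (creationN K (0 : Lp ℂ 2 σ)) = 0 := by
  refine LinearMap.ext fun F => fockFin_ext K fun n => ?_
  cases n with
  | zero => rw [raise_apply_zero]; rfl
  | succ n =>
    rw [raise_apply_succ]
    apply Subtype.ext
    have h : tensorLeft n (0 : Lp ℂ 2 σ) ((F n : QSymm K n) : NSpace σ n) = 0 := by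
      rw [← inner_self_eq_zero (𝕜 := ℂ), inner_tensorLeft, inner_zero_left, zero_mul]
    rw [coe_creationN, h, map_zero]
    rfl

/-- The weight 2! cancels the factor 1/2! of P₂, which leaves one term for the identity and one for
the transposition. -/
theorem fockInner_two (f₁ f₂ g₁ g₂ : Lp ℂ 2 σ) :
    fockInner K (raise K (creationN K f₁) (raise K (creationN K f₂) (vacuum K)))
        (raise K (creationN K g₁) (raise K (creationN K g₂) (vacuum K))) =
      inner ℂ (tensorLeft 1 f₁ (tensorLeft 0 f₂ (vacuumFun σ)))
        (tensorLeft 1 g₁ (tensorLeft 0 g₂ (vacuumFun σ))) +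
      inner ℂ (tensorLeft 1 f₁ (tensorLeft 0 f₂ (vacuumFun σ)))
        (Psi K (Equiv.swap 0 1) (tensorLeft 1 g₁ (tensorLeft 0 g₂ (vacuumFun σ)))) := by
  rw [isDegree_vacuum.raise.raise.fockInner_eq, raise_apply_succ, raise_apply_succ,
    raise_apply_succ, raise_apply_succ, Submodule.coe_inner]
  simp only [coe_creationN, vacuum_apply_zero, symmetrization_tensorLeft_symmetrization]
  rw [inner_symmetrization_left_of_mem K _ (symmetrization_mem K _)]
  have hm : ∀ F : NSpace σ 1, F ∈ QSymm K 1 := fun F =>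
    (mem_QSymm_iff K F).2 fun π => by
      rw [Subsingleton.elim π 1, Psi_one]
      rfl
  have h := inner_symmetrization_of_tail_succ K
    (U := tensorLeft 1 f₁ (tensorLeft 0 f₂ (vacuumFun σ)))
    (H := tensorLeft 1 g₁ (tensorLeft 0 g₂ (vacuumFun σ)))
    (fun e => Psi_extPerm_of_mem K e f₁ (hm _)) (fun e => Psi_extPerm_of_mem K e g₁ (hm _))
  simpa using h

end Degree

/-! ### Fourth and fifth moments of test functions with zero product -/

section Moments

variable {T : Type*} [TopologicalSpace T] [MeasurableSpace T]
variable {σ : Measure T} [SigmaFinite σ] [IsFiniteMeasureOnCompacts σ] (K : StatisticsKernel σ)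

theorem coeFn_tensorLeft_toL2 (f g : TestFunction T) :
    tensorLeft 1 (f.toL2 σ) (tensorLeft 0 (g.toL2 σ) (vacuumFun σ))
      =ᵐ[Measure.pi fun _ : Fin 2 => σ] fun t => f.toComplex (t 0) * g.toComplex (t 1) := by
  filter_upwards [coeFn_tensorLeft (f.toL2 σ) (tensorLeft 0 (g.toL2 σ) (vacuumFun σ)),
    (quasiMeasurePreserving_tail 1).ae (coeFn_tensorLeft (g.toL2 σ) (vacuumFun σ)),
    (quasiMeasurePreserving_head 1).ae (f.memLp σ).coeFn_toLp,
    (quasiMeasurePreserving_tail 1).ae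
      ((quasiMeasurePreserving_head 0).ae (g.memLp σ).coeFn_toLp),
    (quasiMeasurePreserving_tail 1).ae
      ((quasiMeasurePreserving_tail 0).ae (memLp_vacuumFun σ).coeFn_toLp)] with t h1 h2 h3 h4 h5
  rw [h1, h2, h3, h4]
  have h6 : vacuumFun σ (Fin.tail (Fin.tail t)) = 1 := h5
  rw [h6, mul_one]
  rfl

theorem integral_fin_two (G : T × T → ℂ) :
    ∫ t : Fin 2 → T, G (t 0, t 1) ∂(Measure.pi fun _ : Fin 2 => σ) = ∫ p, G p ∂σ.prod σ :=
  (measurePreserving_finTwoArrow σ).integral_comp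
    (MeasurableEquiv.finTwoArrow (α := T)).measurableEmbedding G

theorem fockInner_two_toL2 (f₁ f₂ g₁ g₂ : TestFunction T) :
    fockInner K
        (raise K (creationN K (f₁.toL2 σ)) (raise K (creationN K (f₂.toL2 σ)) (vacuum K)))
        (raise K (creationN K (g₁.toL2 σ)) (raise K (creationN K (g₂.toL2 σ)) (vacuum K))) =
      (∫ p, f₁.toComplex p.1 * f₂.toComplex p.2 * (g₁.toComplex p.1 * g₂.toComplex p.2)
        ∂σ.prod σ) +
      ∫ p, f₁.toComplex p.1 * f₂.toComplex p.2 * (g₂.toComplex p.1 * g₁.toComplex p.2) *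
        K.qfun p.1 p.2 ∂σ.prod σ := by
  have hc : ∀ (f : TestFunction T) t, conj (f.toComplex t) = f.toComplex t :=
    fun f t => Complex.conj_ofReal _
  rw [fockInner_two, L2.inner_def, L2.inner_def]
  congr 1
  · rw [← integral_fin_two]
    refine integral_congr_ae ?_
    filter_upwards [coeFn_tensorLeft_toL2 (σ := σ) f₁ f₂, coeFn_tensorLeft_toL2 (σ := σ) g₁ g₂]
      with t h1 h2
    rw [h1, h2]
    simp only [RCLike.inner_apply, map_mul, hc]
    ring
  · rw [← integral_fin_two]
    refine integral_congr_ae ?_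
    filter_upwards [coeFn_tensorLeft_toL2 (σ := σ) f₁ f₂,
      (quasiMeasurePreserving_perm (Equiv.swap 0 1)).ae (coeFn_tensorLeft_toL2 (σ := σ) g₁ g₂),
      Psi_swap K 0 (tensorLeft 1 (g₁.toL2 σ) (tensorLeft 0 (g₂.toL2 σ) (vacuumFun σ)))]
      with t h1 h2 h3
    simp only [Fin.castSucc_zero, Fin.succ_zero_eq_one] at h3
    rw [h1, h3, h2]
    simp only [RCLike.inner_apply, map_mul, hc, Function.comp_apply, Equiv.swap_apply_left,
      Equiv.swap_apply_right]
    ring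

variable {f g : TestFunction T}

/-- The commutator is creation by the product of the two functions, which is zero here; in the
idempotent case below it is `f` again. -/
theorem neutralOp_raise_of_mul_eq_zero (h : ∀ t, f.toFun t * g.toFun t = 0) (F : FockFin K) :
    neutralOp K f (raise K (creationN K (g.toL2 σ)) F) =
      raise K (creationN K (g.toL2 σ)) (neutralOp K f F) := by
  have h1 := LinearMap.congr_fun
    (neutral_mul_creation K f.measurable_toComplex f.norm_toComplex_le (g.toL2 σ)) F
  have h2 : mulOp f.toComplex
      (memLp_top_of_norm_le σ f.measurable_toComplex f.norm_toComplex_le) (g.toL2 σ) = 0 := by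
    apply Lp.ext
    filter_upwards [coeFn_mulOp f.toComplex
      (memLp_top_of_norm_le σ f.measurable_toComplex f.norm_toComplex_le) (g.toL2 σ),
      (g.memLp σ).coeFn_toLp, Lp.coeFn_zero ℂ 2 σ] with t h1 h2 h3
    rw [h1, h2, h3, TestFunction.toComplex, TestFunction.toComplex, ← Complex.ofReal_mul, h]
    simp
  rw [h2, creation_eq_raise, creation_eq_raise, raise_creationN_zero, zero_add] at h1
  exact h1

theorem neutralOp_raise_of_idempotent (h : ∀ t, f.toFun t * f.toFun t = f.toFun t)
    (F : FockFin K) :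
    neutralOp K f (raise K (creationN K (f.toL2 σ)) F) =
      raise K (creationN K (f.toL2 σ)) F +
        raise K (creationN K (f.toL2 σ)) (neutralOp K f F) := by
  have h1 := LinearMap.congr_fun
    (neutral_mul_creation K f.measurable_toComplex f.norm_toComplex_le (f.toL2 σ)) F
  have h2 : mulOp f.toComplex
      (memLp_top_of_norm_le σ f.measurable_toComplex f.norm_toComplex_le) (f.toL2 σ) =
      f.toL2 σ := by
    apply Lp.ext
    filter_upwards [coeFn_mulOp f.toComplex
      (memLp_top_of_norm_le σ f.measurable_toComplex f.norm_toComplex_le) (f.toL2 σ),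
      (f.memLp σ).coeFn_toLp] with t h1 h2
    rw [h1, h2, TestFunction.toComplex, ← Complex.ofReal_mul, h]
  rw [h2, creation_eq_raise] at h1
  exact h1

theorem inner_toL2_of_mul_eq_zero (h : ∀ t, f.toFun t * g.toFun t = 0) :
    inner ℂ (f.toL2 σ) (g.toL2 σ) = 0 := by
  rw [L2.inner_def]
  refine integral_eq_zero_of_ae ?_
  filter_upwards [(f.memLp σ).coeFn_toLp, (g.memLp σ).coeFn_toLp] with t h1 h2
  rw [h1, h2]
  simp only [RCLike.inner_apply, TestFunction.toComplex, Complex.conj_ofReal, Pi.zero_apply]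
  rw [← Complex.ofReal_mul, mul_comm, h, Complex.ofReal_zero]

/-- The neutral part passes the creation operator and dies on the vacuum; the annihilation part
gives ⟨f, g⟩Ω = 0. Only creation survives. -/
theorem field_raise_vacuum (lam : ℝ) (h : ∀ t, f.toFun t * g.toFun t = 0) :
    field K lam f (raise K (creationN K (g.toL2 σ)) (vacuum K)) =
      raise K (creationN K (f.toL2 σ)) (raise K (creationN K (g.toL2 σ)) (vacuum K)) := by
  rw [field_eq]
  simp only [LinearMap.add_apply, LinearMap.smul_apply]
  rw [neutralOp_raise_of_mul_eq_zero K h, neutral_vacuum, map_zero, smul_zero, add_zero,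
    lower_raise_vacuum, inner_toL2_of_mul_eq_zero h, zero_smul, add_zero]

variable {K} {lam : ℝ} (htr : ∀ p₁ ∈ polyAlgebra K lam, ∀ p₂ ∈ polyAlgebra K lam,
  vacuumState K (p₁ * p₂) = vacuumState K (p₂ * p₁))

theorem field_mem_polyAlgebra (f : TestFunction T) : field K lam f ∈ polyAlgebra K lam :=
  Algebra.subset_adjoin ⟨f, rfl⟩

include htr

/-- This is τ(f · gfg) = τ(gfg · f), with half of each word moved to the other vacuum. -/
theorem fourth_moment_of_tracial (h : ∀ t, f.toFun t * g.toFun t = 0) :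
    fockInner K
        (raise K (creationN K (g.toL2 σ)) (raise K (creationN K (f.toL2 σ)) (vacuum K)))
        (raise K (creationN K (f.toL2 σ)) (raise K (creationN K (g.toL2 σ)) (vacuum K))) =
    fockInner K
        (raise K (creationN K (f.toL2 σ)) (raise K (creationN K (g.toL2 σ)) (vacuum K)))
        (raise K (creationN K (g.toL2 σ)) (raise K (creationN K (f.toL2 σ)) (vacuum K))) := by
  have h' : ∀ t, g.toFun t * f.toFun t = 0 := fun t => by rw [mul_comm, h]
  have hf := field_mem_polyAlgebra (K := K) (lam := lam) f
  have hg := field_mem_polyAlgebra (K := K) (lam := lam) g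
  have h1 := htr _ hf _ (mul_mem hg (mul_mem hf hg))
  simp only [vacuumState, Module.End.mul_apply] at h1
  simp only [← fockInner_field] at h1
  rw [← field_raise_vacuum K lam h, ← field_raise_vacuum K lam h', ← field_vacuum K lam,
    ← field_vacuum K lam]
  -- By Hermiticity all four fields end up in the first argument, in the hypothesis and in the goal,
  -- where the two agree.
  rw [fockInner_field, fockInner_field] at h1 ⊢
  simp only [← fockInner_field] at h1 ⊢
  exact h1

/-- This is τ(fgfg · f) = τ(f · fgfg). An odd word in the fields needs the neutral part to return to
the vacuum, and exactly one factor λ appears on each side. -/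
theorem fifth_moment_of_tracial (h : ∀ t, f.toFun t * g.toFun t = 0)
    (hff : ∀ t, f.toFun t * f.toFun t = f.toFun t) :
    (lam : ℂ) * fockInner K
        (raise K (creationN K (g.toL2 σ)) (raise K (creationN K (f.toL2 σ)) (vacuum K)))
        (raise K (creationN K (g.toL2 σ)) (raise K (creationN K (f.toL2 σ)) (vacuum K))) =
    (lam : ℂ) * fockInner K
        (raise K (creationN K (g.toL2 σ)) (raise K (creationN K (f.toL2 σ)) (vacuum K)))
        (raise K (creationN K (f.toL2 σ)) (raise K (creationN K (g.toL2 σ)) (vacuum K))) := by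
  have h' : ∀ t, g.toFun t * f.toFun t = 0 := fun t => by rw [mul_comm, h]
  have hf := field_mem_polyAlgebra (K := K) (lam := lam) f
  have hg := field_mem_polyAlgebra (K := K) (lam := lam) g
  have htr' := htr _ (mul_mem hf (mul_mem hg (mul_mem hf hg))) _ hf
  simp only [vacuumState, Module.End.mul_apply] at htr'
  have hl : ∀ G, fockInner K (vacuum K) (field K lam f (field K lam g G)) =
      fockInner K (field K lam g (field K lam f (vacuum K))) G := fun G => by
    rw [fockInner_field, fockInner_field]
  have hr : ∀ G, fockInner K (vacuum K) (field K lam f (field K lam f (field K lam g G))) =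
      fockInner K (field K lam g (field K lam f (field K lam f (vacuum K)))) G := fun G => by
    rw [fockInner_field, fockInner_field, fockInner_field]
  rw [hl, hr] at htr'
  simp only [field_vacuum, field_raise_vacuum K lam h, field_raise_vacuum K lam h'] at htr'
  set u := raise K (creationN K (g.toL2 σ)) (raise K (creationN K (f.toL2 σ)) (vacuum K))
  set v := raise K (creationN K (f.toL2 σ)) (raise K (creationN K (g.toL2 σ)) (vacuum K))
  have hu : IsDegree K 2 u := isDegree_vacuum.raise.raise
  have hv : IsDegree K 2 v := isDegree_vacuum.raise.raise
  -- Creation and annihilation change the degree, so only the neutral part counts. It fixes `u`, one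
  -- of whose two factors is the idempotent `f` while the other is annihilated by it.
  have h1 : fockInner K u (field K lam f u) = lam * fockInner K u u := by
    have hn : neutralOp K f u = u := by
      rw [neutralOp_raise_of_mul_eq_zero K h, neutralOp_raise_of_idempotent K hff,
        neutral_vacuum, map_zero, add_zero]
    rw [field_eq]
    simp only [LinearMap.add_apply, LinearMap.smul_apply, map_add, map_smul, smul_eq_mul]
    rw [hu.fockInner_raise_self, hu.fockInner_lower_eq_zero hu (by omega), hn]
    ring
  -- Applied to the one-particle vector `f`, the field gives f ⊛ f + λ f + ⟨f, f⟩Ω. After applying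
  -- the field of `g`, only λ f has a part of degree two, namely λ u: on f ⊛ f the neutral part
  -- vanishes because fg = 0.
  have h2 : fockInner K v (field K lam g (field K lam f
      (raise K (creationN K (f.toL2 σ)) (vacuum K)))) = lam * fockInner K v u := by
    have e1 : field K lam f (raise K (creationN K (f.toL2 σ)) (vacuum K)) =
        raise K (creationN K (f.toL2 σ)) (raise K (creationN K (f.toL2 σ)) (vacuum K)) +
        (lam : ℂ) • raise K (creationN K (f.toL2 σ)) (vacuum K) +
        inner ℂ (f.toL2 σ) (f.toL2 σ) • vacuum K := by
      conv_lhs => rw [field_eq]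
      simp only [LinearMap.add_apply, LinearMap.smul_apply]
      rw [neutralOp_raise_of_idempotent K hff, neutral_vacuum, map_zero, add_zero,
        lower_raise_vacuum]
    have hw : IsDegree K 2
        (raise K (creationN K (f.toL2 σ)) (raise K (creationN K (f.toL2 σ)) (vacuum K))) :=
      isDegree_vacuum.raise.raise
    have e2 : fockInner K v (field K lam g
        (raise K (creationN K (f.toL2 σ)) (raise K (creationN K (f.toL2 σ)) (vacuum K)))) = 0 := by
      rw [field_eq]
      simp only [LinearMap.add_apply, LinearMap.smul_apply, map_add, map_smul, smul_eq_mul]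
      rw [hv.fockInner_eq_zero hw.raise (by omega), hv.fockInner_lower_eq_zero hw (by omega),
        neutralOp_raise_of_mul_eq_zero K h', neutralOp_raise_of_mul_eq_zero K h',
        neutral_vacuum]
      simp only [map_zero]
      ring
    rw [e1]
    simp only [map_add, map_smul, smul_eq_mul]
    rw [e2, field_vacuum, field_raise_vacuum K lam h',
      hv.fockInner_eq_zero isDegree_vacuum.raise (by omega)]
    ring
  rw [h1, ← fockInner_conj K v, h2, map_mul, Complex.conj_ofReal, fockInner_conj] at htr'
  exact htr'

end Moments

/-! ### Functions determined by rectangles with disjoint sides -/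

section Support

variable {T : Type*} [TopologicalSpace T] [MeasurableSpace T]

/-- The indicator function of a measurable set which is contained in a compact set. -/
def TestFunction.ofSet {A k : Set T} (hA : MeasurableSet A) (hk : IsCompact k)
    (hk' : IsClosed k) (hAk : A ⊆ k) : TestFunction T where
  toFun := A.indicator fun _ => 1
  measurable := measurable_const.indicator hA
  bounded := ⟨1, fun t => by by_cases h : t ∈ A <;> simp [h]⟩
  hasCompactSupport := HasCompactSupport.intro' hk hk' fun t ht =>
    Set.indicator_of_notMem (fun h => ht (hAk h)) _

theorem integrableOn_of_norm_le_of_isCompact {σ : Measure T} [SigmaFinite σ]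
    [IsFiniteMeasureOnCompacts σ] {A B k : Set T} {G : T × T → ℂ}
    (hG : Measurable G) {C : ℝ}
    (hC : ∀ p, ‖G p‖ ≤ C) (hk : IsCompact k) (hAk : A ⊆ k) (hBk : B ⊆ k) :
    IntegrableOn G (A ×ˢ B) (σ.prod σ) := by
  refine IntegrableOn.of_bound ?_ hG.aestronglyMeasurable C (Eventually.of_forall hC)
  rw [Measure.prod_prod]
  exact ENNReal.mul_lt_top ((measure_mono hAk).trans_lt hk.measure_lt_top)
    ((measure_mono hBk).trans_lt hk.measure_lt_top)

/-- A bounded measurable function of two variables whose integrals over all products of disjoint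
relatively compact sets are zero vanishes almost everywhere off the diagonal. -/
theorem ae_eq_zero_of_forall_disjoint_rectangle [T2Space T] [SecondCountableTopology T]
    [LocallyCompactSpace T] [BorelSpace T] (σ : Measure T) [SigmaFinite σ]
    [IsFiniteMeasureOnCompacts σ] {G : T × T → ℂ} (hG : Measurable G) {C : ℝ}
    (hC : ∀ p, ‖G p‖ ≤ C)
    (h : ∀ A B k, MeasurableSet A → MeasurableSet B → IsCompact k → A ⊆ k → B ⊆ k →
      Disjoint A B → ∫ p in A ×ˢ B, G p ∂σ.prod σ = 0) :
    ∀ᵐ p ∂σ.prod σ, p.1 ≠ p.2 → G p = 0 := by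
  -- Products of disjoint basic open sets, cut down to compact sets, are countably many and cover
  -- the complement of the diagonal.
  have : ∀ n : ℕ, ∀ U ∈ TopologicalSpace.countableBasis T,
      ∀ V ∈ TopologicalSpace.countableBasis T, Disjoint U V → ∀ᵐ p ∂σ.prod σ,
      p ∈ (U ∩ compactCovering T n) ×ˢ (V ∩ compactCovering T n) → G p = 0 := by
    intro n U hU V hV hUV
    have hk := isCompact_compactCovering T n
    have hU' := (TopologicalSpace.isOpen_of_mem_countableBasis hU).measurableSet.inter
      hk.measurableSet
    have hV' := (TopologicalSpace.isOpen_of_mem_countableBasis hV).measurableSet.inter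
      hk.measurableSet
    rw [← ae_restrict_iff' (hU'.prod hV')]
    refine Integrable.ae_eq_zero_of_forall_rectangle ?_ fun A B hA hB => ?_
    · exact integrableOn_of_norm_le_of_isCompact hG hC hk Set.inter_subset_right
        Set.inter_subset_right
    · rw [Measure.restrict_restrict (hA.prod hB), Set.prod_inter_prod]
      exact h _ _ _ (hA.inter hU') (hB.inter hV') hk
        (Set.inter_subset_right.trans Set.inter_subset_right)
        (Set.inter_subset_right.trans Set.inter_subset_right)
        (hUV.mono (Set.inter_subset_right.trans Set.inter_subset_left)
          (Set.inter_subset_right.trans Set.inter_subset_left))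
  have hc := TopologicalSpace.countable_countableBasis T
  have h2 : ∀ᵐ p ∂σ.prod σ, ∀ n : ℕ, ∀ U ∈ TopologicalSpace.countableBasis T,
      ∀ V ∈ TopologicalSpace.countableBasis T, Disjoint U V →
      p ∈ (U ∩ compactCovering T n) ×ˢ (V ∩ compactCovering T n) → G p = 0 :=
    ae_all_iff.2 fun n => (ae_ball_iff hc).2 fun U hU => (ae_ball_iff hc).2 fun V hV => by
      by_cases hUV : Disjoint U V
      · filter_upwards [this n U hU V hV hUV] with p hp using fun _ => hp
      · exact Eventually.of_forall fun p h => absurd h hUV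
  filter_upwards [h2] with p hp hne
  obtain ⟨u, v, hu, hv, hpu, hpv, huv⟩ := t2_separation hne
  obtain ⟨U, hU, hpU, hUu⟩ :=
    (TopologicalSpace.isBasis_countableBasis T).exists_subset_of_mem_open hpu hu
  obtain ⟨V, hV, hpV, hVv⟩ :=
    (TopologicalSpace.isBasis_countableBasis T).exists_subset_of_mem_open hpv hv
  obtain ⟨m, hm⟩ := exists_mem_compactCovering p.1
  obtain ⟨n, hn⟩ := exists_mem_compactCovering p.2
  exact hp (max m n) U hU V hV (huv.mono hUu hVv)
    ⟨⟨hpU, compactCovering_subset T (le_max_left m n) hm⟩,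
      ⟨hpV, compactCovering_subset T (le_max_right m n) hn⟩⟩

end Support

/-! ### Necessity: traciality forces `Q` to be real, and equal to one if λ ≠ 0 -/

section Necessity

variable {T : Type*} [TopologicalSpace T] [MeasurableSpace T]
variable {σ : Measure T} [SigmaFinite σ] [IsFiniteMeasureOnCompacts σ] (K : StatisticsKernel σ)

variable {A B k : Set T} (hA : MeasurableSet A) (hB : MeasurableSet B) (hk : IsCompact k)
  (hk' : IsClosed k) (hAk : A ⊆ k) (hBk : B ⊆ k) (hAB : Disjoint A B)

include hAB in
theorem ofSet_mul_ofSet_of_disjoint (t : T) :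
    (TestFunction.ofSet hA hk hk' hAk).toFun t * (TestFunction.ofSet hB hk hk' hBk).toFun t =
      0 := by
  by_cases h : t ∈ A
  · simp [TestFunction.ofSet, hAB.notMem_of_mem_left h]
  · simp [TestFunction.ofSet, h]

theorem ofSet_mul_self (t : T) :
    (TestFunction.ofSet hA hk hk' hAk).toFun t * (TestFunction.ofSet hA hk hk' hAk).toFun t =
      (TestFunction.ofSet hA hk hk' hAk).toFun t := by
  by_cases h : t ∈ A <;> simp [TestFunction.ofSet, h]

theorem ofSet_toComplex (t : T) :
    (TestFunction.ofSet hA hk hk' hAk).toComplex t = A.indicator (fun _ => 1) t := by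
  by_cases h : t ∈ A <;> simp [TestFunction.ofSet, TestFunction.toComplex, h]

/-- The vector `1_A ⊛ 1_B`. -/
def pairVector {A B k : Set T} (hA : MeasurableSet A) (hB : MeasurableSet B) (hk : IsCompact k)
    (hk' : IsClosed k) (hAk : A ⊆ k) (hBk : B ⊆ k) : FockFin K :=
  raise K (creationN K ((TestFunction.ofSet hA hk hk' hAk).toL2 σ))
    (raise K (creationN K ((TestFunction.ofSet hB hk hk' hBk).toL2 σ)) (vacuum K))

include hAB in
-- The transposition term contains 1_A 1_B at a single point, so disjointness removes it and with it
-- any dependence on `Q`.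
theorem fockInner_pairVector_self :
    fockInner K (pairVector K hA hB hk hk' hAk hBk) (pairVector K hA hB hk hk' hAk hBk) =
      ∫ p in A ×ˢ B, (1 : ℂ) ∂σ.prod σ := by
  rw [pairVector, fockInner_two_toL2, ← integral_indicator (hA.prod hB)]
  simp only [ofSet_toComplex]
  have h1 : ∀ p : T × T, A.indicator (fun _ => (1 : ℂ)) p.1 * B.indicator (fun _ => 1) p.2 *
      (B.indicator (fun _ => 1) p.1 * A.indicator (fun _ => 1) p.2) * K.qfun p.1 p.2 = 0 := by
    intro p
    by_cases h : p.1 ∈ A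
    · simp [hAB.notMem_of_mem_left h]
    · simp [h]
  simp only [h1, integral_zero, add_zero]
  refine integral_congr_ae (Eventually.of_forall fun p => ?_)
  by_cases h : p.1 ∈ A <;> by_cases h' : p.2 ∈ B <;> simp [Set.indicator, h, h']

include hAB in
-- Here disjointness removes the identity term instead. The transposition term remains, and through
-- it the state sees `Q`.
theorem fockInner_pairVector_swap :
    fockInner K (pairVector K hA hB hk hk' hAk hBk) (pairVector K hB hA hk hk' hBk hAk) =
      ∫ p in A ×ˢ B, K.qfun p.1 p.2 ∂σ.prod σ := by
  rw [pairVector, pairVector, fockInner_two_toL2, ← integral_indicator (hA.prod hB)]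
  simp only [ofSet_toComplex]
  have h1 : ∀ p : T × T, A.indicator (fun _ => (1 : ℂ)) p.1 * B.indicator (fun _ => 1) p.2 *
      (B.indicator (fun _ => 1) p.1 * A.indicator (fun _ => 1) p.2) = 0 := by
    intro p
    by_cases h : p.1 ∈ A
    · simp [hAB.notMem_of_mem_left h]
    · simp [h]
  simp only [h1, integral_zero, zero_add]
  refine integral_congr_ae (Eventually.of_forall fun p => ?_)
  by_cases h : p.1 ∈ A <;> by_cases h' : p.2 ∈ B <;> simp [Set.indicator, h, h']

variable {K} {lam : ℝ} (htr : ∀ p₁ ∈ polyAlgebra K lam, ∀ p₂ ∈ polyAlgebra K lam,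
  vacuumState K (p₁ * p₂) = vacuumState K (p₂ * p₁))
include htr

variable [T2Space T] [SecondCountableTopology T] [LocallyCompactSpace T] [BorelSpace T]

theorem qfun_conj_of_tracial : ∀ᵐ p ∂σ.prod σ, conj (K.qfun p.1 p.2) = K.qfun p.1 p.2 := by
  have hm := K.measurable_qfun
  have hm' : Measurable fun p : T × T => conj (K.qfun p.1 p.2) :=
    Complex.continuous_conj.measurable.comp hm
  have h0 : ∀ᵐ p ∂σ.prod σ, p.1 ≠ p.2 → conj (K.qfun p.1 p.2) - K.qfun p.1 p.2 = 0 := by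
    refine ae_eq_zero_of_forall_disjoint_rectangle σ (hm'.sub hm) (C := 2) (fun p => ?_)
      fun A B k hA hB hk hAk hBk hAB => ?_
    · refine (norm_sub_le _ _).trans ?_
      rw [RCLike.norm_conj, K.norm_qfun]
      norm_num
    · have h1 := fourth_moment_of_tracial htr (ofSet_mul_ofSet_of_disjoint hB hA hk hk.isClosed
        hBk hAk hAB.symm)
      have h2 := fockInner_pairVector_swap K hA hB hk hk.isClosed hAk hBk hAB
      have h3 := congrArg conj h2
      rw [fockInner_conj, ← integral_conj] at h3
      rw [integral_sub
        (integrableOn_of_norm_le_of_isCompact hm' (C := 1)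
          (fun p => by rw [RCLike.norm_conj, K.norm_qfun]) hk hAk hBk)
        (integrableOn_of_norm_le_of_isCompact hm (C := 1)
          (fun p => (K.norm_qfun _ _).le) hk hAk hBk), ← h2, ← h3, sub_eq_zero]
      exact h1.symm
  filter_upwards [h0] with p hp
  -- On the diagonal, which lies in the exceptional set, the extended function equals 1.
  by_cases h : p.1 = p.2
  · rw [h, K.qfun_self, map_one]
  · exact sub_eq_zero.1 (hp h)

theorem qfun_eq_one_of_tracial (hlam : lam ≠ 0) :
    ∀ᵐ p ∂σ.prod σ, K.qfun p.1 p.2 = 1 := by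
  have hm := K.measurable_qfun
  have h0 : ∀ᵐ p ∂σ.prod σ, p.1 ≠ p.2 → 1 - K.qfun p.1 p.2 = 0 := by
    refine ae_eq_zero_of_forall_disjoint_rectangle σ (measurable_const.sub hm) (C := 2)
      (fun p => ?_) fun A B k hA hB hk hAk hBk hAB => ?_
    · refine (norm_sub_le _ _).trans ?_
      rw [norm_one, K.norm_qfun]
      norm_num
    · have h1 := fifth_moment_of_tracial htr (ofSet_mul_ofSet_of_disjoint hB hA hk hk.isClosed
        hBk hAk hAB.symm) (ofSet_mul_self hB hk hk.isClosed hBk)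
      have h2 := mul_left_cancel₀ (Complex.ofReal_ne_zero.2 hlam) h1
      rw [integral_sub
        (integrableOn_of_norm_le_of_isCompact measurable_const (C := 1)
          (fun p => by rw [norm_one]) hk hAk hBk)
        (integrableOn_of_norm_le_of_isCompact hm (C := 1)
          (fun p => (K.norm_qfun _ _).le) hk hAk hBk),
        ← fockInner_pairVector_swap K hA hB hk hk.isClosed hAk hBk hAB,
        ← fockInner_pairVector_self K hA hB hk hk.isClosed hAk hBk hAB, sub_eq_zero]
      exact h2
  filter_upwards [h0] with p hp
  by_cases h : p.1 = p.2
  · rw [h, K.qfun_self]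
  · exact (sub_eq_zero.1 (hp h)).symm

end Necessity

/-! ### Real statistics functions as twists -/

section Sign

variable {T : Type*} [MeasurableSpace T] {σ : Measure T} (K : StatisticsKernel σ)

/-- The constant twist. -/
def Twist.one (T : Type*) [MeasurableSpace T] : Twist T where
  toFun _ _ := 1
  measurable := measurable_const
  norm_le _ _ := by simp
  real _ _ := by simp

open scoped Classical in
/-- The twist by the statistics function, made real-valued everywhere. -/
def StatisticsKernel.sign : Twist T where
  toFun s t := if K.qfun s t = 1 then 1 else -1
  measurable := Measurable.ite (K.measurable_qfun (measurableSet_singleton 1)) measurable_const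
    measurable_const
  norm_le s t := by split_ifs <;> simp
  real s t := by split_ifs <;> simp

/-- A real value is unchanged when the arguments are interchanged, and a sign is its own inverse. -/
theorem StatisticsKernel.qfun_mul_sign {s t : T} (h : K.qfun s t = 1 ∨ K.qfun s t = -1) :
    K.qfun s t * K.sign.toFun t s = 1 := by
  have h' := K.qfun_conj t s
  rcases h with h | h
  · simp [h, StatisticsKernel.sign, h']
  · have h1 : (-1 : ℂ) ≠ 1 := by norm_num
    simp [h, StatisticsKernel.sign, h', h1]

end Sign

end QFock

end

/-- The vacuum state `τ` on the algebra generated by the operators `⟨f, ω⟩` is tracial if and only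
if either `Q ≡ 1` and `λ ≠ 0`, or `Q` takes values in `{-1, 1}` and `λ = 0`. The statistics
function `Q` is determined, and its values are meant, almost everywhere. -/
theorem mainTheorem5 {T : Type*} [TopologicalSpace T] [PolishSpace T] [LocallyCompactSpace T]
    [MeasurableSpace T] [BorelSpace T] (σ : MeasureTheory.Measure T) [σ.Regular]
    [MeasureTheory.NullSingletonClass σ] (K : QFock.StatisticsKernel σ) (lam : ℝ) :
    (∀ p₁ ∈ QFock.polyAlgebra K lam, ∀ p₂ ∈ QFock.polyAlgebra K lam,
        QFock.vacuumState K (p₁ * p₂) = QFock.vacuumState K (p₂ * p₁)) ↔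
      ((∀ᵐ p ∂σ.prod σ, ∀ h : p ∉ K.A, K.Q ⟨p, h⟩ = 1) ∧ lam ≠ 0) ∨
        ((∀ᵐ p ∂σ.prod σ, ∀ h : p ∉ K.A, K.Q ⟨p, h⟩ = 1 ∨ K.Q ⟨p, h⟩ = -1) ∧ lam = 0) := by
  have hq : ∀ p (h : p ∉ K.A), K.qfun p.1 p.2 = K.Q ⟨p, h⟩ := fun p h => by
    rw [QFock.StatisticsKernel.qfun, dif_pos h]
  have hq' : ∀ p ∈ K.A, K.qfun p.1 p.2 = 1 := fun p h => by
    rw [QFock.StatisticsKernel.qfun, dif_neg (not_not.2 h)]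
  constructor
  · intro htr
    by_cases hlam : lam = 0
    · right
      refine ⟨?_, hlam⟩
      filter_upwards [QFock.qfun_conj_of_tracial htr] with p hp h
      rw [← hq]
      -- For a real value, Q(s, t) Q(t, s) = 1 becomes Q(s, t)² = 1.
      have h1 := K.qfun_mul_swap p.1 p.2
      rw [K.qfun_conj p.2 p.1, hp] at h1
      exact mul_self_eq_one_iff.1 h1
    · left
      refine ⟨?_, hlam⟩
      filter_upwards [QFock.qfun_eq_one_of_tracial htr hlam] with p hp h
      rw [← hq, hp]
  -- Any twist inverting `Q` supplies the commuting partners of the fields; the two cases differ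
  -- only in the choice of twist.
  · have key : ∀ τ : QFock.Twist T, (∀ᵐ p ∂σ.prod σ, K.qfun p.1 p.2 * τ.toFun p.2 p.1 = 1) →
        (lam = 0 ∨ ∀ n t, τ.prod n t = 1) → ∀ p₁ ∈ QFock.polyAlgebra K lam,
        ∀ p₂ ∈ QFock.polyAlgebra K lam,
        QFock.vacuumState K (p₁ * p₂) = QFock.vacuumState K (p₂ * p₁) :=
      fun τ hτ hlam p₁ h₁ p₂ h₂ => QFock.vacuumState_mul_comm (QFock.rightField K τ lam)
        (QFock.fockInner_rightField K τ lam) (QFock.rightField_vacuum K τ lam)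
        (QFock.field_mul_rightField lam hτ hlam) h₁ h₂
    rintro (⟨h, -⟩ | ⟨h, hlam⟩)
    · refine key (QFock.Twist.one T) ?_ (.inr fun n t => by simp [QFock.Twist.prod, QFock.Twist.one])
      filter_upwards [h] with p hp
      by_cases hpA : p ∈ K.A
      · simp [hq' p hpA, QFock.Twist.one]
      · simp [hq p hpA, hp hpA, QFock.Twist.one]
    · refine key K.sign ?_ (.inl hlam)
      filter_upwards [h] with p hp
      apply K.qfun_mul_sign
      by_cases hpA : p ∈ K.A
      · exact .inl (hq' p hpA)
      · rw [hq p hpA]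
        exact hp hpA
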